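/- **Setting.** Let $\mathcal X\subset\mathbb R^n$ be compact with convex hull $\mathcal K$, $A\in\mathbb R^{n\times n}$, $b\in\mathbb R^n$, and consider $\dot x=Ax+b\,(f(x)+g(x)u)$ with states $x\in\mathcal X$ and unknown $f,g:\mathbb R^n\to\mathbb R$. *Prior, data, posterior.* A priori $f$ and $g$ are independent centred Gaussian processes with kernels $k_f,k_g$, where $k_f(x,x)=s_f^2$, $s_f\ge0$. A fixed data set $\mathbb D=\{(x^{(i)},u^{(i)},y^{(i)})\}_{i=1}^N$ is given, with $y^{(i)}=f(x^{(i)})+g(x^{(i)})u^{(i)}+\omega^{(i)}$ and independent noise $\omega^{(i)}\sim\mathcal N(0,\sigma_{\rm on}^2)$, $\sigma_{\rm on}>0$. The posterior probability is the prior conditioned on $\mathbb D$ by Bayes' rule. With $K_{ij}=k_f(x^{(i)},x^{(j)})+u^{(i)}k_g(x^{(i)},x^{(j)})u^{(j)}$, $M=(K+\sigma_{\rm on}^2I)^{-1}$, $U_{\mathbb D}=\operatorname{diag}(u^{(1)},\dots,u^{(N)})$, $\mathbf k_{f,i}(x)=k_f(x,x^{(i)})$, $\mathbf k_{g,i}(x)=k_g(x,x^{(i)})$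 put $$\mu_f=\mathbf k_f^TMy,\quad \mu_g=\mathbf k_g^TU_{\mathbb D}My,\quad \sigma_f^2(x)=k_f(x,x)-\mathbf k_f^TM\mathbf k_f,\quad \sigma_g^2(x)=k_g(x,x)-\mathbf k_g^TU_{\mathbb D}MU_{\mathbb D}\mathbf k_g .$$ Let $\mu_f,\mu_g,\sigma_f,\sigma_g$ be Lipschitz on $\mathcal K$ with constants $L_{\mu_f},L_{\mu_g},L_{\sigma_f},L_{\sigma_g}$. Fix $L_f,L_g\ge 0$, $\delta\in(0,1)$, $\underline\sigma_f,\underline\sigma_g>0$, and put $\tilde\sigma_f=\max\{\sigma_f,\underline\sigma_f\}$, $\tilde\sigma_g=\max\{\sigma_g,\underline\sigma_g\}$ and, for $h\in\{f,g\}$, $$\tau_h=\frac{\underline\sigma_h}{L_h+L_{\mu_h}+L_{\sigma_h}},\qquad \beta_h=8\log\Big(\frac2\delta\prod_{j=1}^n\Big(\frac{\sqrt n}{2\tau_h}\big(\max_{x\in\mathcal X}x_j-\min_{x\in\mathcal X}x_j\big)+1\Big)\Big)$$ (with $1/\tau_h=0$ if $L_h+L_{\mu_h}+L_{\sigma_h}=0$).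 *Barrier function.* Let $\psi$ be $C^2$ on an open neighbourhood of $\mathcal X$, $\mathcal C=\{x\in\mathcal X:\psi(x)\ge0\}$, and suppose that all points with $\psi\ge0$ in some open neighbourhood of $\mathcal C$ belong to $\mathcal X$ (e.g. $\mathcal C\subset\operatorname{int}\mathcal X$). Let $\alpha:\mathbb R\to\mathbb R$ be a Lipschitz extended class $\mathcal K_\infty$ function such that $\psi$ is a control barrier function for the nominal linear system ($f=0$, $g=1$): for each $x\in\mathcal C$ some $u$ in the input set $\mathcal U\subseteq\mathbb R$ satisfies $\nabla\psi(x)^TAx+\alpha(\psi(x))+\nabla\psi(x)^Tb\,u\ge0$. Let $\pi_{\rm nom}:\mathcal X\to\mathbb R$ be Lipschitz. *Gradient condition.* For some $\zeta_1>0$ and $\bar f\in\mathbb R$ with $\zeta_2:=\zeta_1(\bar f+2\sqrt{\beta_f}s_f)>0$: $\alpha(\psi(x))\ge-\nabla\psi(x)^TAx+\zeta_2$ for all $x\in\mathcal X$ with $|\nabla\psi(x)^Tb|\le\zeta_1$. *Excitation condition.* $\mu_g(x)/(\sqrt{\beta_g}\,\tilde\sigma_g(x))>1$ for all $x\in\mathcal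 X$. **Claim.** Consider the filter $\pi(x)=\arg\min_{u\in\mathbb R}|u-\pi_{\rm nom}(x)|$ subject to $\xi_s(x)u\le\xi_3(x)$, where $$\xi_1=|\nabla\psi^Tb|\sqrt{\beta_g}\tilde\sigma_g,\quad \xi_2=-\nabla\psi^Tb\,\mu_g,\quad \xi_3=\alpha(\psi)+\nabla\psi^TAx+\nabla\psi^Tb\,\mu_f-|\nabla\psi^Tb|\sqrt{\beta_f}\tilde\sigma_f,\quad \xi_s=\operatorname{sgn}(\xi_2\xi_3)\xi_1+\xi_2 .$$ 1. The filter is feasible at every $x\in\mathcal X$ and has exactly one minimizer $\pi(x)$, and $\pi$ is (globally) Lipschitz on $\mathcal X$. 2. Let $\underline g>0$. There is an event of posterior probability at least $1-\delta$ on which the following holds: if $f$ and $g$ are Lipschitz on $\mathcal K$ with constants $L_f$ and $L_g$, and $f\le\bar f$, $g\ge\underline g$ on $\mathcal X$, then from every $x_0\in\mathcal C$ the closed loop $\dot x=Ax+b(f(x)+g(x)\pi(x))$ has a unique solution in $\mathcal X$ for all $t\ge0$, and it stays in $\mathcal C$ for all $t\ge0$. -/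

import Mathlib

open MeasureTheory ProbabilityTheory Filter Topology
open scoped NNReal ENNReal Gradient RealInnerProductSpace

noncomputable section

namespace SafeGP

/-- The state space `ℝⁿ` with the Euclidean norm. -/
abbrev State (n : ℕ) : Type := EuclideanSpace ℝ (Fin n)

/-! ### Control barrier functions -/

/-- Extended class `K_∞` functions. -/
structure IsExtendedClassK (α : ℝ → ℝ) : Prop where
  continuous : Continuous α
  strictMono : StrictMono α
  map_zero : α 0 = 0
  tendsto_atTop : Tendsto α atTop atTop
  tendsto_atBot : Tendsto α atBot atBot

/-- Right-hand side of `ẋ = A x + b (f(x) + g(x) u)`. -/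
def dynamics {n : ℕ} (A : Matrix (Fin n) (Fin n) ℝ) (b : State n) (f g : State n → ℝ)
    (x : State n) (u : ℝ) : State n :=
  Matrix.toEuclideanLin A x + (f x + g x * u) • b

/-- `ψ`, together with `α`, is a control barrier function for `ẋ = A x + b (f(x) + g(x) u)` with
inputs `u ∈ U` on the set `C`: at every `x ∈ C` some `u ∈ U` satisfies `c(x) + d(x) u ≥ 0`. -/
def IsCBF {n : ℕ} (A : Matrix (Fin n) (Fin n) ℝ) (b : State n) (f g : State n → ℝ)
    (U : Set ℝ) (ψ : State n → ℝ) (α : ℝ → ℝ) (C : Set (State n)) : Prop :=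
  IsExtendedClassK α ∧
    ∀ x ∈ C, ∃ u ∈ U,
      0 ≤ (⟪∇ ψ x, Matrix.toEuclideanLin A x + f x • b⟫ + α (ψ x)) + (⟪∇ ψ x, b⟫ * g x) * u

/-! ### Gaussian process priors, data, Bayesian posterior -/

/-- `F` is a centred Gaussian process with covariance kernel `k` under `P`. -/
structure IsCenteredGP {n : ℕ} {Ω : Type*} [MeasurableSpace Ω] (F : State n → Ω → ℝ)
    (k : State n → State n → ℝ) (P : Measure Ω) : Prop where
  isGaussianProcess : IsGaussianProcess F P
  mean_eq_zero : ∀ x, ∫ ω, F x ω ∂P = 0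
  covariance_eq : ∀ x x', cov[F x, F x'; P] = k x x'

/-- A data set of `N` triples (state, input, measured output). -/
structure Dataset (n N : ℕ) where
  x : Fin N → State n
  u : Fin N → ℝ
  y : Fin N → ℝ

/-- Likelihood of the outputs `y⁽ⁱ⁾ = f(x⁽ⁱ⁾) + g(x⁽ⁱ⁾) u⁽ⁱ⁾ + ω⁽ⁱ⁾`, with independent noise
`ω⁽ⁱ⁾ ∼ 𝒩(0, σ²)`, when the unknown functions are `f` and `g`. -/
def likelihood {n N : ℕ} (D : Dataset n N) (σ : ℝ≥0) (f g : State n → ℝ) : ℝ≥0∞ :=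
  ∏ i, gaussianPDF (f (D.x i) + g (D.x i) * D.u i) (σ ^ 2) (D.y i)

/-- Bayesian posterior: the prior measure `P`, under which `F` and `G` are the random functions
`f` and `g`, conditioned on the data set (the prior reweighted by the likelihood of the data and
normalised). -/
def posterior {n N : ℕ} {Ω : Type*} [MeasurableSpace Ω] (P : Measure Ω)
    (F G : State n → Ω → ℝ) (D : Dataset n N) (σ : ℝ≥0) : Measure Ω :=
  (∫⁻ ω, likelihood D σ (fun x => F x ω) (fun x => G x ω) ∂P)⁻¹ •
    P.withDensity (fun ω => likelihood D σ (fun x => F x ω) (fun x => G x ω))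

/-! ### The objects of the problem -/

/-- All the parameters of the problem; no property of them is assumed here. -/
structure Setup (n N : ℕ) where
  /-- system matrix -/
  A : Matrix (Fin n) (Fin n) ℝ
  /-- input vector -/
  b : State n
  /-- domain of the states -/
  X : Set (State n)
  /-- set of inputs -/
  U : Set ℝ
  /-- barrier function -/
  ψ : State n → ℝ
  /-- extended class `K_∞` function that belongs to `ψ` -/
  α : ℝ → ℝ
  /-- nominal control law -/
  πnom : State n → ℝ
  /-- prior covariance kernel of `f` -/
  kf : State n → State n → ℝ
  /-- prior covariance kernel of `g` -/
  kg : State n → State n → ℝ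
  /-- standard deviation of the measurement noise -/
  σon : ℝ≥0
  /-- the data set -/
  D : Dataset n N
  /-- the constant `s_f`, with `s_f² = k_f(x, x)` -/
  sf : ℝ
  /-- upper bound of `f` -/
  fbar : ℝ
  /-- lower bound of `g` -/
  glow : ℝ
  /-- Lipschitz constant of `f` -/
  Lf : ℝ≥0
  /-- Lipschitz constant of `g` -/
  Lg : ℝ≥0
  /-- Lipschitz constant of the posterior mean of `f` -/
  Lμf : ℝ≥0
  /-- Lipschitz constant of the posterior mean of `g` -/
  Lμg : ℝ≥0
  /-- Lipschitz constant of the posterior standard deviation of `f` -/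
  Lσf : ℝ≥0
  /-- Lipschitz constant of the posterior standard deviation of `g` -/
  Lσg : ℝ≥0
  /-- admissible probability of failure -/
  δ : ℝ
  /-- floor of the standard deviation of `f` -/
  σlowf : ℝ
  /-- floor of the standard deviation of `g` -/
  σlowg : ℝ
  /-- threshold in the gradient condition -/
  ζ₁ : ℝ

namespace Setup

variable {n N : ℕ} (S : Setup n N)

/-- The safe set `C`. -/
def safeSet : Set (State n) := {x ∈ S.X | 0 ≤ S.ψ x}

/-! Gaussian process regression with the composite kernel -/

/-- Gram matrix of the composite kernel `k_f(x, x') + u k_g(x, x') u'`. -/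
def gram : Matrix (Fin N) (Fin N) ℝ :=
  Matrix.of fun i j =>
    S.kf (S.D.x i) (S.D.x j) + S.D.u i * S.kg (S.D.x i) (S.D.x j) * S.D.u j

/-- `(K_h + σ_on² I)⁻¹`. -/
def invGram : Matrix (Fin N) (Fin N) ℝ := (S.gram + ((S.σon : ℝ) ^ 2) • 1)⁻¹

/-- The vector `k_f(x)`. -/
def kvecf (x : State n) : Fin N → ℝ := fun i => S.kf x (S.D.x i)

/-- The vector `U k_g(x)`, with `U = diag(u⁽¹⁾, …, u⁽ᴺ⁾)`. -/
def kvecg (x : State n) : Fin N → ℝ :=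
  Matrix.mulVec (Matrix.diagonal S.D.u) (fun i => S.kg x (S.D.x i))

/-- Posterior mean of `f`. -/
def μf (x : State n) : ℝ := S.kvecf x ⬝ᵥ Matrix.mulVec S.invGram S.D.y

/-- Posterior mean of `g`. -/
def μg (x : State n) : ℝ := S.kvecg x ⬝ᵥ Matrix.mulVec S.invGram S.D.y

/-- Posterior standard deviation of `f`. -/
def σf (x : State n) : ℝ :=
  √(S.kf x x - S.kvecf x ⬝ᵥ Matrix.mulVec S.invGram (S.kvecf x))

/-- Posterior standard deviation of `g`. -/
def σg (x : State n) : ℝ :=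
  √(S.kg x x - S.kvecg x ⬝ᵥ Matrix.mulVec S.invGram (S.kvecg x))

/-- `σ̃_f = max {σ_f, floor}`. -/
def σtf (x : State n) : ℝ := max (S.σf x) S.σlowf

/-- `σ̃_g = max {σ_g, floor}`. -/
def σtg (x : State n) : ℝ := max (S.σg x) S.σlowg

/-- `max_{x ∈ X} x_j - min_{x ∈ X} x_j`. -/
def width (j : Fin n) : ℝ :=
  sSup ((fun x : State n => x j) '' S.X) - sInf ((fun x : State n => x j) '' S.X)

/-- Resolution of the covering for `f`. -/
def τf : ℝ := S.σlowf / (S.Lf + S.Lμf + S.Lσf)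

/-- Resolution of the covering for `g`. -/
def τg : ℝ := S.σlowg / (S.Lg + S.Lμg + S.Lσg)

/-- The scaling factor `β_f`. If the three Lipschitz constants vanish, every factor of the product
is `1`, which is also the value for `τ_f → ∞`. -/
def βf : ℝ := 8 * Real.log (2 / S.δ * ∏ j : Fin n, (√n / (2 * S.τf) * S.width j + 1))

/-- The scaling factor `β_g`. -/
def βg : ℝ := 8 * Real.log (2 / S.δ * ∏ j : Fin n, (√n / (2 * S.τg) * S.width j + 1))

/-- `ζ₂ = ζ₁ (f̄ + 2 √β_f s_f)`. -/
def ζ₂ : ℝ := S.ζ₁ * (S.fbar + 2 * √S.βf * S.sf)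

/-! The safety filter -/

def ξ₁ (x : State n) : ℝ := |⟪∇ S.ψ x, S.b⟫| * √S.βg * S.σtg x

def ξ₂ (x : State n) : ℝ := -⟪∇ S.ψ x, S.b⟫ * S.μg x

def ξ₃ (x : State n) : ℝ :=
  S.α (S.ψ x) + ⟪∇ S.ψ x, Matrix.toEuclideanLin S.A x⟫ + ⟪∇ S.ψ x, S.b⟫ * S.μf x
    - |⟪∇ S.ψ x, S.b⟫| * √S.βf * S.σtf x

def ξs (x : State n) : ℝ := Real.sign (S.ξ₂ x * S.ξ₃ x) * S.ξ₁ x + S.ξ₂ x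

/-- The inputs that satisfy the constraint of the filter at `x`. -/
def feasibleInputs (x : State n) : Set ℝ := {u | S.ξs x * u ≤ S.ξ₃ x}

/-- `u` solves the quadratic program
`min |u - π_nom(x)|` subject to `ξ_s(x) u ≤ ξ₃(x)`. -/
def IsFilterInput (x : State n) (u : ℝ) : Prop :=
  u ∈ S.feasibleInputs x ∧ ∀ v ∈ S.feasibleInputs x, |u - S.πnom x| ≤ |v - S.πnom x|

/-! Unknown functions and closed loop -/

/-- The assumptions on the unknown functions: `f` and `g` have the Lipschitz constants `L_f`,
`L_g` (on the convex hull of `X`), `f ≤ f̄` and `g ≥ g̲` on `X`. -/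
structure Admissible (f g : State n → ℝ) : Prop where
  lipschitz_f : LipschitzOnWith S.Lf f (convexHull ℝ S.X)
  lipschitz_g : LipschitzOnWith S.Lg g (convexHull ℝ S.X)
  le_fbar : ∀ x ∈ S.X, f x ≤ S.fbar
  glow_le : ∀ x ∈ S.X, S.glow ≤ g x

/-- `x` is, on the time interval `I`, a solution in `X` of the closed loop
`ẋ = A x + b (f(x) + g(x) π(x))`. -/
def IsClosedLoopSolution (f g π : State n → ℝ) (I : Set ℝ) (x : ℝ → State n) : Prop :=
  ∀ t ∈ I, x t ∈ S.X ∧ HasDerivWithinAt x (dynamics S.A S.b f g (x t) (π (x t))) I t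

/-- The closed loop under `π` is safe: from every initial state in `C` there is a solution for all
`t ≥ 0`, it stays in `C`, and every other solution from that state coincides with it as long as
it exists (so that no solution leaves `C`). -/
def IsSafe (f g π : State n → ℝ) : Prop :=
  ∀ x₀ ∈ S.safeSet, ∃ x : ℝ → State n, x 0 = x₀ ∧
    S.IsClosedLoopSolution f g π (Set.Ici 0) x ∧
    (∀ t, 0 ≤ t → x t ∈ S.safeSet) ∧
    ∀ (T : ℝ) (z : ℝ → State n), z 0 = x₀ →
      S.IsClosedLoopSolution f g π (Set.Icc 0 T) z → Set.EqOn z x (Set.Icc 0 T)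

end Setup

end SafeGP

end

/-! The claim joins a probabilistic estimate to a deterministic invariance argument; they meet in
the uniform error bounds |f - μ_f| ≤ √β_f σ̃_f and |g - μ_g| ≤ √β_g σ̃_g on `X`.

Posterior. Let Z be a value of f or g and Y the noisy outputs. The residual Z - aᵀY of the best
linear prediction is uncorrelated with Y, hence independent of it by joint Gaussianity. Comparing
E[exp(itZ); Y ∈ B] computed by this independence with the same quantity computed by Fubini
identifies the posterior characteristic function for almost every data vector; continuity in the
data gives the actual one (`integral_cexp_mul_noisePDF`). So the posterior law of Z is Gaussian with
the stated mean and variance. A Gaussian tail bound, a union bound over a grid of at most δ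
exp(β/8)/2 points and the Lipschitz constants yield each error bound outside an event of probability
δ/2 (`exists_small_set_uniform_bound`).

Filter. Write d = ∇ψᵀb and s = √β_g σ̃_g. Since μ_g > s > 0, ξ_s = -d (μ_g + sgn(ξ₃) s), and
dividing by the positive bracket turns the constraint into 0 ≤ r + d u, where r = ξ₃⁺/(μ_g + s) -
ξ₃⁻/(μ_g - s) is locally Lipschitz although the sign jumps (`exists_normalisation`). The minimizer
is the projection onto a half-line. Where d = 0 the gradient condition forces r > 0, so the
constraint is inactive nearby and the division by d is harmless. Compactness of `X` makes the local
Lipschitz bounds global.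

Safety. The sign in ξ_s selects the worst g in the error band, so the filter enforces α(ψ) + ∇ψᵀẋ ≥
0 for the true system (`barrier_condition`). Zeros of ψ are regular, again by the gradient
condition. As `X` need not contain a neighbourhood of the safe set, the closed loop is extended to a
bounded Lipschitz field on the whole space, about which only inwardness on {ψ = 0} is used; a
comparison argument (`forward_invariant`) keeps its solution in the safe set, where it solves the
original equation. -/

noncomputable section

namespace SafeGP

/-! ### Gaussian regression -/

section GaussianRegression

variable {ι : Type*} [Fintype ι]

/-- Density of a vector of independent centred Gaussians with variance `v`. -/
def noisePDF (v : ℝ≥0) (e : ι → ℝ) : ℝ := ∏ i, gaussianPDFReal 0 v (e i)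

lemma continuous_gaussianPDFReal (m : ℝ) (v : ℝ≥0) : Continuous (gaussianPDFReal m v) := by
  rw [gaussianPDFReal_def]
  fun_prop

lemma gaussianPDFReal_le (m : ℝ) (v : ℝ≥0) (x : ℝ) :
    gaussianPDFReal m v x ≤ (√(2 * Real.pi * v))⁻¹ := by
  rw [gaussianPDFReal]
  refine mul_le_of_le_one_right (by positivity) (Real.exp_le_one_iff.2 ?_)
  rw [neg_div]
  exact neg_nonpos.2 (by positivity)

@[fun_prop]
lemma continuous_noisePDF (v : ℝ≥0) : Continuous (noisePDF v : (ι → ℝ) → ℝ) := by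
  unfold noisePDF
  have := continuous_gaussianPDFReal 0 v
  fun_prop

@[fun_prop]
lemma measurable_noisePDF (v : ℝ≥0) : Measurable (noisePDF v : (ι → ℝ) → ℝ) :=
  (continuous_noisePDF v).measurable

lemma noisePDF_nonneg (v : ℝ≥0) (e : ι → ℝ) : 0 ≤ noisePDF v e :=
  Finset.prod_nonneg fun _ _ => gaussianPDFReal_nonneg _ _ _

lemma noisePDF_pos {v : ℝ≥0} (hv : v ≠ 0) (e : ι → ℝ) : 0 < noisePDF v e :=
  Finset.prod_pos fun _ _ => gaussianPDFReal_pos _ _ _ hv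

lemma exists_noisePDF_le (v : ℝ≥0) : ∃ c, ∀ e : ι → ℝ, noisePDF v e ≤ c :=
  ⟨∏ _i : ι, (√(2 * Real.pi * v))⁻¹, fun _ =>
    Finset.prod_le_prod (fun _ _ => gaussianPDFReal_nonneg _ _ _)
      fun _ _ => gaussianPDFReal_le _ _ _⟩

lemma integrable_noisePDF (v : ℝ≥0) : Integrable (noisePDF v : (ι → ℝ) → ℝ) :=
  Integrable.fintype_prod (μ := fun _ : ι => (volume : Measure ℝ)) (f := fun _ => gaussianPDFReal 0 v)
    fun _ => integrable_gaussianPDFReal 0 v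

/-- Law of a vector of independent centred Gaussians with variance `v`. -/
def noise (ι : Type*) [Fintype ι] (v : ℝ≥0) : Measure (ι → ℝ) :=
  Measure.pi fun _ => gaussianReal 0 v

lemma noise_eq_withDensity {v : ℝ≥0} (hv : v ≠ 0) :
    noise ι v = volume.withDensity fun e => ENNReal.ofReal (noisePDF v e) := by
  refine Measure.pi_eq fun s hs => ?_
  rw [withDensity_apply _ (MeasurableSet.univ_pi hs),
    ← ofReal_integral_eq_lintegral_ofReal (integrable_noisePDF v).integrableOn
      (Eventually.of_forall fun _ => noisePDF_nonneg _ _), volume_pi, Measure.restrict_pi_pi]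
  unfold noisePDF
  rw [integral_fintype_prod_eq_prod (fun i x => gaussianPDFReal 0 v x),
    ENNReal.ofReal_prod_of_nonneg fun _ _ => integral_nonneg fun _ => gaussianPDFReal_nonneg _ _ _]
  exact Finset.prod_congr rfl fun i _ => (gaussianReal_apply_eq_integral 0 hv _).symm

instance (v : ℝ≥0) : IsProbabilityMeasure (noise ι v) := by unfold noise; infer_instance

instance (v : ℝ≥0) : IsGaussian (noise ι v) := by
  have h : iIndepFun (fun (i : ι) (e : ι → ℝ) => e i) (noise ι v) :=
    iIndepFun_pi (X := fun _ => id) fun _ => aemeasurable_id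
  have h2 := h.hasGaussianLaw fun i => by
    have : (noise ι v).map (fun e => e i) = gaussianReal 0 v :=
      (measurePreserving_eval (fun _ : ι => gaussianReal 0 v) i).map_eq
    exact ⟨by rw [this]; infer_instance⟩
  simpa using h2.isGaussian_map

lemma covariance_noise [DecidableEq ι] (v : ℝ≥0) (i j : ι) :
    cov[fun e => e i, fun e => e j; noise ι v] = if i = j then (v : ℝ) else 0 := by
  have hm (i : ι) : MemLp (fun e : ι → ℝ => e i) 2 (noise ι v) :=
    (HasGaussianLaw.map_fun (IsGaussian.hasGaussianLaw_id (μ := noise ι v))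
      (ContinuousLinearMap.proj (R := ℝ) (φ := fun _ : ι => ℝ) i)).memLp_two
  split_ifs with h
  · subst h
    rw [covariance_self (hm i).aestronglyMeasurable.aemeasurable]
    have := (measurePreserving_eval (fun _ : ι => gaussianReal 0 v) i).variance_fun_comp
      (f := id) (by fun_prop)
    exact (this.trans variance_id_gaussianReal)
  · have h' : iIndepFun (fun (i : ι) (e : ι → ℝ) => e i) (noise ι v) :=
      iIndepFun_pi (X := fun _ => id) fun _ => aemeasurable_id
    exact (h'.indepFun h).covariance_eq_zero (hm i) (hm j)

lemma integral_noise (v : ℝ≥0) (i : ι) : ∫ e, e i ∂noise ι v = 0 := by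
  have := integral_map (μ := noise ι v) (φ := fun e => e i) (f := fun x : ℝ => x)
    (measurable_pi_apply i).aemeasurable (by fun_prop)
  rw [← this, noise, (measurePreserving_eval (fun _ : ι => gaussianReal 0 v) i).map_eq]
  exact integral_id_gaussianReal

variable {E : Type*} [MeasurableSpace E]

lemma integrable_prod_noisePDF (v : ℝ≥0) (ρ : Measure E) [IsProbabilityMeasure ρ] {V : E → ι → ℝ}
    (hV : Measurable V) :
    Integrable (fun x : E × (ι → ℝ) => noisePDF v (x.2 - V x.1)) (ρ.prod volume) := by
  rw [integrable_prod_iff (by fun_prop)]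
  refine ⟨Eventually.of_forall fun p => (integrable_noisePDF (ι := ι) v).comp_sub_right (V p), ?_⟩
  have (p : E) : ∫ y, ‖noisePDF v (y - V p)‖ = ∫ y : ι → ℝ, ‖noisePDF v y‖ :=
    integral_sub_right_eq_self (fun y : ι → ℝ => ‖noisePDF v y‖) _
  simp_rw [this]
  exact integrable_const _

/-- Integration against an observation `V` corrupted by independent noise. -/
lemma integral_mul_comp_add_noise {v : ℝ≥0} (hv : v ≠ 0) (ρ : Measure E) [IsProbabilityMeasure ρ]
    {V : E → ι → ℝ} (hV : Measurable V) {g : E → ℂ} {h : (ι → ℝ) → ℂ} (hg : Measurable g)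
    (hh : Measurable h) (hg1 : ∀ p, ‖g p‖ ≤ 1) (hh1 : ∀ y, ‖h y‖ ≤ 1) :
    ∫ x, g x.1 * h (V x.1 + x.2) ∂ρ.prod (noise ι v) =
      ∫ y, h y * ∫ p, g p * noisePDF v (y - V p) ∂ρ := by
  have hb : Integrable (fun x : E × (ι → ℝ) => g x.1 * h (V x.1 + x.2))
      (ρ.prod (noise ι v)) := by
    refine Integrable.of_bound (by fun_prop) 1 (Eventually.of_forall fun x => ?_)
    rw [norm_mul]
    exact mul_le_one₀ (hg1 _) (norm_nonneg _) (hh1 _)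
  rw [integral_prod _ hb]
  have key (p : E) : ∫ e, g p * h (V p + e) ∂noise ι v =
      ∫ y, h y * (g p * noisePDF v (y - V p)) := by
    -- The substitution e = y - V p moves the dependence on the signal from `h` into the noise
    -- density.
    rw [noise_eq_withDensity hv, integral_withDensity_eq_integral_toReal_smul (by fun_prop)
      (Eventually.of_forall fun _ => ENNReal.ofReal_lt_top),
      ← integral_sub_right_eq_self _ (V p)]
    refine integral_congr_ae (Eventually.of_forall fun y => ?_)
    simp only [ENNReal.toReal_ofReal (noisePDF_nonneg v _), add_sub_cancel, Complex.real_smul]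
    ring
  simp_rw [key]
  rw [integral_integral_swap]
  · simp_rw [integral_const_mul]
  · refine Integrable.mono' (integrable_prod_noisePDF v ρ hV) (by fun_prop)
      (Eventually.of_forall fun x => ?_)
    simp only [Function.uncurry, norm_mul, Complex.norm_real, Real.norm_eq_abs,
      abs_of_nonneg (noisePDF_nonneg v _)]
    calc _ ≤ 1 * (1 * noisePDF v (x.2 - V x.1)) := by
          have := noisePDF_nonneg v (x.2 - V x.1)
          gcongr
          · exact hh1 _
          · exact hg1 _
      _ = _ := by ring

lemma integrable_integral_mul_noisePDF (v : ℝ≥0) (ρ : Measure E) [IsProbabilityMeasure ρ]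
    {V : E → ι → ℝ} (hV : Measurable V) {g : E → ℂ} (hg : Measurable g) (hg1 : ∀ p, ‖g p‖ ≤ 1) :
    Integrable fun y => ∫ p, g p * noisePDF v (y - V p) ∂ρ := by
  have h : Integrable (fun x : E × (ι → ℝ) => g x.1 * noisePDF v (x.2 - V x.1))
      (ρ.prod volume) := by
    refine Integrable.mono' (integrable_prod_noisePDF v ρ hV) (by fun_prop)
      (Eventually.of_forall fun x => ?_)
    rw [norm_mul, Complex.norm_real, Real.norm_eq_abs, abs_of_nonneg (noisePDF_nonneg v _)]
    exact mul_le_of_le_one_left (noisePDF_nonneg _ _) (hg1 _)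
  exact h.integral_prod_right

/-- Conditioning through test sets only determines densities for almost every y; this continuity
gives the identity at the particular data vector. -/
lemma continuous_integral_mul_noisePDF (v : ℝ≥0) (ρ : Measure E) [IsProbabilityMeasure ρ]
    {V : E → ι → ℝ} (hV : Measurable V) {g : E → ℂ} (hg : Measurable g) (hg1 : ∀ p, ‖g p‖ ≤ 1) :
    Continuous fun y => ∫ p, g p * noisePDF v (y - V p) ∂ρ := by
  obtain ⟨c, hc⟩ := exists_noisePDF_le (ι := ι) v
  refine continuous_of_dominated (bound := fun _ => c) (fun y => by fun_prop)
    (fun y => Eventually.of_forall fun p => ?_) (integrable_const _)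
    (Eventually.of_forall fun p => by fun_prop)
  rw [norm_mul, Complex.norm_real, Real.norm_eq_abs, abs_of_nonneg (noisePDF_nonneg v _)]
  exact (mul_le_of_le_one_left (noisePDF_nonneg _ _) (hg1 _)).trans (hc _)

end GaussianRegression

/-! ### Conditioning a Gaussian vector on noisy observations -/

section Residual

variable {ι : Type*} [Fintype ι] {v : ℝ≥0} {ρ : Measure (ℝ × (ι → ℝ))}
  [IsGaussian ρ] {a : ι → ℝ}

/-- The residual of the linear prediction of the first component from the noisy observations. -/
def residual (a : ι → ℝ) (x : (ℝ × (ι → ℝ)) × (ι → ℝ)) : ℝ :=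
  x.1.1 - ∑ i, a i * (x.1.2 i + x.2 i)

/-- Joint Gaussianity of the residual and of the observations. -/
lemma hasGaussianLaw_residual :
    HasGaussianLaw (fun x : (ℝ × (ι → ℝ)) × (ι → ℝ) =>
      ((fun _ : Unit => residual a x), fun j => x.1.2 j + x.2 j)) (ρ.prod (noise ι v)) := by
  let L : ((ℝ × (ι → ℝ)) × (ι → ℝ)) →ₗ[ℝ] ((Unit → ℝ) × (ι → ℝ)) :=
    { toFun := fun x => ((fun _ : Unit => residual a x), fun j => x.1.2 j + x.2 j)
      map_add' := fun x y => by
        ext <;> simp [residual, mul_add, Finset.sum_add_distrib] <;> ring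
      map_smul' := fun c x => by
        ext
        · simp only [residual, Prod.smul_fst, Prod.smul_snd, smul_eq_mul, Pi.smul_apply,
            RingHom.id_apply, mul_sub, Finset.mul_sum]
          congr 1
          exact Finset.sum_congr rfl fun i _ => by ring
        · simp [mul_add] }
  exact (IsGaussian.hasGaussianLaw_id (μ := ρ.prod (noise ι v))).map
    (LinearMap.toContinuousLinearMap L)

lemma memLp_two_of_eq_clm {F : Type*} [NormedAddCommGroup F] [NormedSpace ℝ F]
    [MeasurableSpace F] [BorelSpace F] [CompleteSpace F] [SecondCountableTopology F]
    {μ : Measure F} [IsGaussian μ] {f : F → ℝ} (L : F →L[ℝ] ℝ) (hf : ∀ x, f x = L x) :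
    MemLp f 2 μ := by
  rw [funext hf]
  exact (HasGaussianLaw.map_fun (IsGaussian.hasGaussianLaw_id (μ := μ)) L).memLp_two

lemma memLp_coord {μ : Measure (ι → ℝ)} [IsGaussian μ] (i : ι) :
    MemLp (fun e : ι → ℝ => e i) 2 μ :=
  memLp_two_of_eq_clm (ContinuousLinearMap.proj (R := ℝ) (φ := fun _ : ι => ℝ) i) fun _ => rfl

lemma memLp_prod_fst : MemLp (fun p : ℝ × (ι → ℝ) => p.1) 2 ρ :=
  memLp_two_of_eq_clm (ContinuousLinearMap.fst ℝ ℝ (ι → ℝ)) fun _ => rfl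

lemma memLp_prod_snd (i : ι) : MemLp (fun p : ℝ × (ι → ℝ) => p.2 i) 2 ρ :=
  memLp_two_of_eq_clm ((ContinuousLinearMap.proj (R := ℝ) (φ := fun _ : ι => ℝ) i).comp
    (ContinuousLinearMap.snd ℝ ℝ (ι → ℝ))) fun _ => rfl

lemma memLp_fst : MemLp (fun x : (ℝ × (ι → ℝ)) × (ι → ℝ) => x.1.1) 2 (ρ.prod (noise ι v)) :=
  memLp_prod_fst.comp_fst _

lemma memLp_observation (j : ι) :
    MemLp (fun x : (ℝ × (ι → ℝ)) × (ι → ℝ) => x.1.2 j + x.2 j) 2 (ρ.prod (noise ι v)) :=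
  ((memLp_prod_snd j).comp_fst _).add ((memLp_coord j).comp_snd _)

lemma memLp_residual : MemLp (residual a) 2 (ρ.prod (noise ι v)) :=
  memLp_fst.sub (memLp_finsetSum _ fun i _ => (memLp_observation i).const_mul _)

lemma covariance_signal {ρ : Measure (ℝ × (ι → ℝ))} [SFinite ρ] {f g : ℝ × (ι → ℝ) → ℝ} (hf : Continuous f) (hg : Continuous g) :
    cov[fun x => f x.1, fun x => g x.1; ρ.prod (noise ι v)] = cov[f, g; ρ] := by
  rw [← covariance_map_fun (Z := Prod.fst) hf.aestronglyMeasurable hg.aestronglyMeasurable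
    (by fun_prop), Measure.map_fst_prod]
  simp

lemma covariance_noise_snd [DecidableEq ι] (i j : ι) :
    cov[fun x => x.2 i, fun x => x.2 j; ρ.prod (noise ι v)] = if i = j then (v : ℝ) else 0 := by
  rw [← covariance_noise, ← covariance_map_fun (Z := Prod.snd)
    (X := fun e : ι → ℝ => e i) (Y := fun e : ι → ℝ => e j)
    (continuous_apply i).aestronglyMeasurable (continuous_apply j).aestronglyMeasurable
    (by fun_prop), Measure.map_snd_prod]
  simp

lemma covariance_observation [DecidableEq ι] (i j : ι) :
    cov[fun x => x.1.2 i + x.2 i, fun x => x.1.2 j + x.2 j; ρ.prod (noise ι v)] =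
      cov[fun p => p.2 i, fun p => p.2 j; ρ] + if i = j then (v : ℝ) else 0 := by
  have h1 (i : ι) : MemLp (fun p : ℝ × (ι → ℝ) => p.2 i) 2 ρ := memLp_prod_snd i
  have h2 (i : ι) : MemLp (fun e : ι → ℝ => e i) 2 (noise ι v) := memLp_coord i
  have m1 (i : ι) : MemLp (fun x : (ℝ × (ι → ℝ)) × (ι → ℝ) => x.1.2 i) 2
    (ρ.prod (noise ι v)) := (h1 i).comp_fst _
  have m2 (i : ι) : MemLp (fun x : (ℝ × (ι → ℝ)) × (ι → ℝ) => x.2 i) 2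
    (ρ.prod (noise ι v)) := (h2 i).comp_snd _
  have e1 := covariance_add_left (m1 i) (m2 i) ((m1 j).add (m2 j))
  have e2 := covariance_add_right (m1 i) (m1 j) (m2 j)
  have e3 := covariance_add_right (m2 i) (m1 j) (m2 j)
  have e4 : cov[fun x => x.1.2 i, fun x => x.1.2 j; ρ.prod (noise ι v)] = _ :=
    covariance_signal (f := fun p : ℝ × (ι → ℝ) => p.2 i) (g := fun p => p.2 j)
      (by fun_prop) (by fun_prop)
  have e5 := covariance_fst_snd_prod (h1 i) (h2 j)
  have e6 := covariance_fst_snd_prod (h1 j) (h2 i)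
  rw [covariance_comm] at e6
  have e7 := covariance_noise_snd (ρ := ρ) (v := v) i j
  rw [e2, e3, e4, e5, e6, e7] at e1
  simpa using! e1

lemma covariance_fst_observation (j : ι) :
    cov[fun x => x.1.1, fun x => x.1.2 j + x.2 j; ρ.prod (noise ι v)] =
      cov[fun p => p.1, fun p => p.2 j; ρ] := by
  have h0 : MemLp (fun p : ℝ × (ι → ℝ) => p.1) 2 ρ := memLp_prod_fst
  have h1 (i : ι) : MemLp (fun p : ℝ × (ι → ℝ) => p.2 i) 2 ρ := memLp_prod_snd i
  have h2 (i : ι) : MemLp (fun e : ι → ℝ => e i) 2 (noise ι v) := memLp_coord i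
  have e1 := covariance_add_right (h0.comp_fst (noise ι v)) ((h1 j).comp_fst (noise ι v))
    ((h2 j).comp_snd ρ)
  have e4 : cov[fun x => x.1.1, fun x => x.1.2 j; ρ.prod (noise ι v)] = _ :=
    covariance_signal (f := fun p : ℝ × (ι → ℝ) => p.1) (g := fun p => p.2 j)
      (by fun_prop) (by fun_prop)
  have e5 := covariance_fst_snd_prod h0 (h2 j)
  calc _ = _ := e1
    _ = _ := by rw [show cov[fun x => x.1.1, fun x => x.1.2 j; ρ.prod (noise ι v)] = _ from e4]
    _ = _ := by rw [e5, add_zero]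

/-- The normal equations for the coefficients of the best linear prediction of the first
component from the noisy observations of the others. -/
def NormalEquations [DecidableEq ι] (v : ℝ≥0) (ρ : Measure (ℝ × (ι → ℝ))) (a : ι → ℝ) : Prop :=
  ∀ j, ∑ i, a i * (cov[fun p => p.2 i, fun p => p.2 j; ρ] + if i = j then (v : ℝ) else 0) =
    cov[fun p => p.1, fun p => p.2 j; ρ]

/-- The normal equations are exactly orthogonality of the residual to each observation, the noise
contributing the diagonal term. -/
lemma covariance_residual_observation [DecidableEq ι] (ha : NormalEquations v ρ a) (j : ι) :
    cov[residual a, fun x => x.1.2 j + x.2 j; ρ.prod (noise ι v)] = 0 := by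
  unfold residual
  rw [covariance_fun_sub_left memLp_fst
    (memLp_finsetSum _ fun i _ => (memLp_observation i).const_mul _)
    (memLp_observation j), covariance_fun_sum_left
      (fun i => (memLp_observation i).const_mul _) (memLp_observation j)]
  simp_rw [covariance_const_mul_left, covariance_observation, covariance_fst_observation]
  exact sub_eq_zero.2 (ha j).symm

/-- Jointly Gaussian and uncorrelated variables are independent. -/
lemma indepFun_residual [DecidableEq ι] (ha : NormalEquations v ρ a) :
    IndepFun (residual a) (fun x => x.1.2 + x.2) (ρ.prod (noise ι v)) := by
  have := hasGaussianLaw_residual.indepFun_of_covariance_eval (X := fun _ : Unit => residual a)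
    (Y := fun j x => x.1.2 j + x.2 j) (P := ρ.prod (noise ι v))
    fun _ j => covariance_residual_observation ha j
  exact this.comp (measurable_pi_apply ()) measurable_id

/-- The residual is uncorrelated with the prediction, so its variance equals its covariance with the
predicted variable. -/
lemma variance_residual [DecidableEq ι] (ha : NormalEquations v ρ a) :
    Var[residual a; ρ.prod (noise ι v)] =
      Var[fun p => p.1; ρ] - ∑ j, a j * cov[fun p => p.1, fun p => p.2 j; ρ] := by
  have hs := memLp_finsetSum (μ := ρ.prod (noise ι v)) Finset.univ
    (f := fun i (x : (ℝ × (ι → ℝ)) × (ι → ℝ)) => a i * (x.1.2 i + x.2 i))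
    fun i _ => (memLp_observation i).const_mul _
  have hr : cov[residual a, fun x => ∑ i, a i * (x.1.2 i + x.2 i); ρ.prod (noise ι v)] = 0 := by
    rw [covariance_fun_sum_right (fun i => (memLp_observation i).const_mul _)
      memLp_residual]
    simp_rw [covariance_const_mul_right, covariance_residual_observation ha, mul_zero,
      Finset.sum_const_zero]
  rw [← covariance_self memLp_residual.aestronglyMeasurable.aemeasurable]
  have e1 : cov[residual a, residual a; ρ.prod (noise ι v)] =
      cov[residual a, fun x => x.1.1; ρ.prod (noise ι v)] -
        cov[residual a, fun x => ∑ i, a i * (x.1.2 i + x.2 i); ρ.prod (noise ι v)] :=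
    covariance_fun_sub_right memLp_residual memLp_fst hs
  have e2 : cov[residual a, fun x => x.1.1; ρ.prod (noise ι v)] =
      cov[fun x => x.1.1, fun x => x.1.1; ρ.prod (noise ι v)] -
        cov[fun x => ∑ i, a i * (x.1.2 i + x.2 i), fun x => x.1.1; ρ.prod (noise ι v)] :=
    covariance_fun_sub_left memLp_fst hs memLp_fst
  rw [e1, hr, sub_zero, e2, covariance_signal (by fun_prop) (by fun_prop),
    covariance_self (by fun_prop), covariance_comm, covariance_fun_sum_right
      (fun i => (memLp_observation i).const_mul _) memLp_fst]
  simp_rw [covariance_const_mul_right, covariance_fst_observation]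

lemma integral_residual (h1 : ∫ p, p.1 ∂ρ = 0) (h2 : ∀ i, ∫ p, p.2 i ∂ρ = 0) :
    ∫ x, residual a x ∂ρ.prod (noise ι v) = 0 := by
  unfold residual
  have hi (i : ι) : Integrable (fun x : (ℝ × (ι → ℝ)) × (ι → ℝ) => a i * (x.1.2 i + x.2 i))
    (ρ.prod (noise ι v)) := ((memLp_observation i).integrable one_le_two).const_mul _
  rw [integral_sub (memLp_fst.integrable one_le_two) (integrable_finsetSum _ fun i _ => hi i),
    integral_finsetSum _ fun i _ => hi i]
  have e1 : ∫ x : (ℝ × (ι → ℝ)) × (ι → ℝ), x.1.1 ∂ρ.prod (noise ι v) = 0 := by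
    have := integral_fun_fst (μ := ρ) (ν := noise ι v) (fun p : ℝ × (ι → ℝ) => p.1)
    simpa [h1] using this
  have e2 (i : ι) : ∫ x : (ℝ × (ι → ℝ)) × (ι → ℝ), x.1.2 i + x.2 i ∂ρ.prod (noise ι v) = 0 := by
    have i1 : Integrable (fun p : ℝ × (ι → ℝ) => p.2 i) ρ := (memLp_prod_snd i).integrable one_le_two
    have i2 : Integrable (fun e : ι → ℝ => e i) (noise ι v) := (memLp_coord i).integrable one_le_two
    rw [integral_add (i1.comp_fst _) (i2.comp_snd _)]
    have := integral_fun_fst (μ := ρ) (ν := noise ι v) (fun p : ℝ × (ι → ℝ) => p.2 i)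
    have h' := integral_fun_snd (μ := ρ) (ν := noise ι v) (fun e : ι → ℝ => e i)
    rw [this, h', h2, integral_noise]
    simp
  rw [e1]
  simp_rw [integral_const_mul, e2]
  simp

/-- Characteristic function of a Gaussian variable reweighted by the likelihood of noisy
observations `y` of jointly Gaussian variables. -/
theorem integral_cexp_mul_noisePDF [DecidableEq ι] (ha : NormalEquations v ρ a)
    (hv : v ≠ 0) (h1 : ∫ p, p.1 ∂ρ = 0)
    (h2 : ∀ i, ∫ p, p.2 i ∂ρ = 0) (t : ℝ) (y : ι → ℝ) :
    ∫ p, Complex.exp (t * p.1 * Complex.I) * noisePDF v (y - p.2) ∂ρ =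
      charFun (gaussianReal (∑ i, a i * y i)
        (Var[fun p => p.1; ρ] - ∑ j, a j * cov[fun p => p.1, fun p => p.2 j; ρ]).toNNReal) t *
        ∫ p, (noisePDF v (y - p.2) : ℂ) ∂ρ := by
  set s : ℝ≥0 := (Var[fun p => p.1; ρ] -
    ∑ j, a j * cov[fun p => p.1, fun p => p.2 j; ρ]).toNNReal with hs
  have hn (r : ℝ) : ‖Complex.exp (t * r * Complex.I)‖ = 1 := by
    rw [← Complex.ofReal_mul, Complex.norm_exp_ofReal_mul_I]
  have hR : ∫ x, Complex.exp (t * residual a x * Complex.I) ∂ρ.prod (noise ι v) =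
      charFun (gaussianReal 0 s) t := by
    have hg := (hasGaussianLaw_residual (ρ := ρ) (v := v) (a := a)).fst.eval ()
    have hm := hg.map_eq_gaussianReal
    rw [integral_residual h1 h2, show Var[fun x => residual a x; ρ.prod (noise ι v)] = _ from
      variance_residual ha, ← hs] at hm
    rw [← hm, charFun_apply_real, integral_map hg.aemeasurable (by fun_prop)]
  have key : (fun y : ι → ℝ => ∫ p, Complex.exp (t * p.1 * Complex.I) *
      noisePDF v (y - p.2) ∂ρ) = fun y => charFun (gaussianReal 0 s) t *
        (Complex.exp (t * (∑ i, a i * y i : ℝ) * Complex.I) *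
          ∫ p, 1 * (noisePDF v (y - p.2) : ℂ) ∂ρ) := by
    have c1 := continuous_integral_mul_noisePDF v ρ (V := fun p => p.2) measurable_snd
      (g := fun p => Complex.exp (t * p.1 * Complex.I)) (by fun_prop) fun p => (hn _).le
    have c2 := continuous_integral_mul_noisePDF v ρ (V := fun p => p.2) measurable_snd
      (g := fun _ => 1) (by fun_prop) fun p => by simp
    -- Both sides are continuous in y and Lebesgue measure charges every open set, so equality of
    -- integrals over measurable sets `B` is enough.
    refine (Continuous.ae_eq_iff_eq (volume : Measure (ι → ℝ)) c1 (by fun_prop)).1 ?_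
    have i1 := integrable_integral_mul_noisePDF v ρ (V := fun p => p.2) measurable_snd
      (g := fun p => Complex.exp (t * p.1 * Complex.I)) (by fun_prop) fun p => (hn _).le
    have i2 := integrable_integral_mul_noisePDF v ρ (V := fun p => p.2) measurable_snd
      (g := fun _ => 1) (by fun_prop) fun p => by simp
    have i3 : Integrable fun y : ι → ℝ => charFun (gaussianReal 0 s) t *
        (Complex.exp (t * (∑ i, a i * y i : ℝ) * Complex.I) *
          ∫ p, 1 * (noisePDF v (y - p.2) : ℂ) ∂ρ) := by
      refine Integrable.const_mul ?_ _
      exact i2.bdd_mul (c := 1) (Continuous.aestronglyMeasurable (by fun_prop))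
        (Eventually.of_forall fun y => (hn _).le)
    refine ae_eq_of_forall_setIntegral_eq_of_sigmaFinite (fun _ _ _ => i1.integrableOn)
      (fun _ _ _ => i3.integrableOn) fun B hB _ => ?_
    set b : (ι → ℝ) → ℂ := B.indicator fun _ => 1 with hb
    have hbm : Measurable b := measurable_const.indicator hB
    have hb1 (y : ι → ℝ) : ‖b y‖ ≤ 1 := by
      by_cases hy : y ∈ B <;> simp [hb, hy]
    have hset (W : (ι → ℝ) → ℂ) : ∫ y in B, W y = ∫ y, b y * W y := by
      rw [← integral_indicator hB]
      refine integral_congr_ae (Eventually.of_forall fun y => ?_)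
      by_cases hy : y ∈ B <;> simp [hb, hy]
    have e1 := integral_mul_comp_add_noise hv ρ (V := fun p => p.2) measurable_snd
      (g := fun p => Complex.exp (t * p.1 * Complex.I)) (by fun_prop) hbm (fun p => (hn _).le) hb1
    have e2 := integral_mul_comp_add_noise hv ρ (V := fun p => p.2) measurable_snd
      (g := fun _ => 1) (h := fun y => b y * Complex.exp (t * (∑ i, a i * y i : ℝ) * Complex.I))
      (by fun_prop) (by fun_prop) (fun p => by simp) fun y => by
        rw [norm_mul, hn, mul_one]; exact hb1 y
    rw [hset, hset, ← e1]
    have e3 (y : ι → ℝ) : b y * (charFun (gaussianReal 0 s) t *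
        (Complex.exp (t * (∑ i, a i * y i : ℝ) * Complex.I) *
          ∫ p, 1 * (noisePDF v (y - p.2) : ℂ) ∂ρ)) = charFun (gaussianReal 0 s) t *
        (b y * Complex.exp (t * (∑ i, a i * y i : ℝ) * Complex.I) *
          ∫ p, 1 * (noisePDF v (y - p.2) : ℂ) ∂ρ) := by ring
    simp_rw [e3]
    rw [integral_const_mul, ← e2, ← hR]
    -- With Y the observations, exp(itZ) = exp(itR) · exp(it aᵀY); independence splits off the
    -- factor of the residual R.
    have hind := (indepFun_residual ha).comp (φ := fun r : ℝ => Complex.exp (t * r * Complex.I))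
      (ψ := fun y : ι → ℝ => b y * Complex.exp (t * (∑ i, a i * y i : ℝ) * Complex.I))
      (by fun_prop) (by fun_prop)
    have hm := memLp_residual (ρ := ρ) (v := v) (a := a) |>.aestronglyMeasurable.aemeasurable
    have := hind.integral_fun_mul_eq_mul_integral
      (AEMeasurable.aestronglyMeasurable (by fun_prop))
      (AEMeasurable.aestronglyMeasurable (by fun_prop))
    simp only [Function.comp_apply] at this
    simp only [one_mul]
    rw [← this]
    refine integral_congr_ae (Eventually.of_forall fun x => ?_)
    simp only [residual, Pi.add_apply]
    rw [mul_left_comm, ← Complex.exp_add, mul_comm]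
    congr 2
    push_cast
    ring
  have := congrFun key y
  simp only [one_mul] at this
  rw [this, ← mul_assoc]
  congr 1
  -- The phase exp(it aᵀy) shifts the centred Gaussian of the residual to mean aᵀy.
  rw [charFun_gaussianReal, charFun_gaussianReal, ← Complex.exp_add]
  congr 1
  push_cast
  ring

/-- Law of a Gaussian variable conditioned on noisy observations `y` of jointly Gaussian
variables. -/
theorem map_fst_conditioned_eq_gaussianReal [DecidableEq ι] (ha : NormalEquations v ρ a)
    (hv : v ≠ 0) (h1 : ∫ p, p.1 ∂ρ = 0) (h2 : ∀ i, ∫ p, p.2 i ∂ρ = 0) (y : ι → ℝ) :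
    ((∫⁻ p, ENNReal.ofReal (noisePDF v (y - p.2)) ∂ρ)⁻¹ •
      ρ.withDensity fun p => ENNReal.ofReal (noisePDF v (y - p.2))).map Prod.fst =
      gaussianReal (∑ i, a i * y i) (Var[fun p => p.1; ρ] -
        ∑ j, a j * cov[fun p => p.1, fun p => p.2 j; ρ]).toNNReal := by
  obtain ⟨c, hc⟩ := exists_noisePDF_le (ι := ι) v
  set q : ℝ × (ι → ℝ) → ℝ := fun p => noisePDF v (y - p.2) with hq
  have hq0 (p) : 0 ≤ q p := noisePDF_nonneg _ _
  have hqc : Continuous q := by fun_prop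
  have hqi : Integrable q ρ := Integrable.of_bound (by fun_prop) c
    (Eventually.of_forall fun p => by rw [Real.norm_of_nonneg (hq0 p)]; exact hc _)
  have hpos : 0 < ∫ p, q p ∂ρ := by
    rw [integral_pos_iff_support_of_nonneg hq0 hqi]
    have : Function.support q = Set.univ := Set.eq_univ_of_forall fun p => (noisePDF_pos hv _).ne'
    simp [this]
  have hl : ∫⁻ p, ENNReal.ofReal (q p) ∂ρ = ENNReal.ofReal (∫ p, q p ∂ρ) :=
    (ofReal_integral_eq_lintegral_ofReal hqi (Eventually.of_forall hq0)).symm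
  have hl0 : ∫⁻ p, ENNReal.ofReal (q p) ∂ρ ≠ 0 := by
    rw [hl]; exact (ENNReal.ofReal_pos.2 hpos).ne'
  have hlt : ∫⁻ p, ENNReal.ofReal (q p) ∂ρ ≠ ∞ := by rw [hl]; exact ENNReal.ofReal_ne_top
  set m := (∫⁻ p, ENNReal.ofReal (q p) ∂ρ)⁻¹ • ρ.withDensity fun p => ENNReal.ofReal (q p) with hm
  have hprob : IsProbabilityMeasure m := ⟨by
    rw [hm, Measure.smul_apply, withDensity_apply _ MeasurableSet.univ, Measure.restrict_univ,
      smul_eq_mul, ENNReal.inv_mul_cancel hl0 hlt]⟩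
  have : IsProbabilityMeasure (m.map Prod.fst) := Measure.isProbabilityMeasure_map (by fun_prop)
  refine Measure.ext_of_charFun (funext fun t => ?_)
  rw [charFun_apply_real, integral_map (by fun_prop) (by fun_prop), hm, integral_smul_measure,
    integral_withDensity_eq_integral_toReal_smul (by fun_prop)
      (Eventually.of_forall fun _ => ENNReal.ofReal_lt_top), ENNReal.toReal_inv, hl,
    ENNReal.toReal_ofReal hpos.le]
  have key := integral_cexp_mul_noisePDF ha hv h1 h2 t y
  have e : ∫ p, (ENNReal.ofReal (q p)).toReal • Complex.exp (t * p.1 * Complex.I) ∂ρ =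
      ∫ p, Complex.exp (t * p.1 * Complex.I) * noisePDF v (y - p.2) ∂ρ := by
    refine integral_congr_ae (Eventually.of_forall fun p => ?_)
    simp only [ENNReal.toReal_ofReal (hq0 p), Complex.real_smul]
    exact mul_comm _ _
  have hne : ((∫ p, q p ∂ρ : ℝ) : ℂ) ≠ 0 := Complex.ofReal_ne_zero.2 hpos.ne'
  rw [e, key, integral_complex_ofReal, Complex.real_smul, Complex.ofReal_inv, mul_left_comm,
    inv_mul_cancel₀ hne, mul_one]

end Residual

/-! ### Transfer to the Bayesian posterior on the probability space -/

section Conditioning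

variable {Ω : Type*} [MeasurableSpace Ω]

lemma map_withDensity_comp {E : Type*} [MeasurableSpace E] {P : Measure Ω} [SFinite P] {T : Ω → E}
    (hT : AEMeasurable T P) {q : E → ℝ≥0∞} (hq : Measurable q) :
    (P.withDensity fun ω => q (T ω)).map T = (P.map T).withDensity q := by
  ext s hs
  have hT' : AEMeasurable T (P.withDensity fun ω => q (T ω)) :=
    hT.mono_ac (withDensity_absolutelyContinuous _ _)
  rw [Measure.map_apply_of_aemeasurable hT' hs, withDensity_apply' _ _, withDensity_apply _ hs,
    ← lintegral_indicator₀ (hT.nullMeasurableSet_preimage hs), ← lintegral_indicator hs,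
    lintegral_map' (hq.indicator hs).aemeasurable hT]
  rfl

/-- Law of a component `Z` of a Gaussian vector under the Bayesian posterior, given noisy
observations `y` of the other components `V`. -/
theorem map_posterior_eq_gaussianReal {ι : Type*} [Fintype ι] [DecidableEq ι] {P : Measure Ω}
    {Z : Ω → ℝ} {V : ι → Ω → ℝ} (hZV : HasGaussianLaw (fun ω => (Z ω, fun i => V i ω)) P)
    (hZ : ∫ ω, Z ω ∂P = 0) (hV : ∀ i, ∫ ω, V i ω ∂P = 0) {v : ℝ≥0} (hv : v ≠ 0) {a : ι → ℝ}
    (ha : ∀ j, ∑ i, a i * (cov[V i, V j; P] + if i = j then (v : ℝ) else 0) = cov[Z, V j; P])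
    (y : ι → ℝ) :
    ((∫⁻ ω, ∏ i, gaussianPDF (V i ω) v (y i) ∂P)⁻¹ •
      P.withDensity fun ω => ∏ i, gaussianPDF (V i ω) v (y i)).map Z =
      gaussianReal (∑ i, a i * y i) (Var[Z; P] - ∑ j, a j * cov[Z, V j; P]).toNNReal := by
  have hP := hZV.isProbabilityMeasure
  have hT := hZV.aemeasurable
  set T : Ω → ℝ × (ι → ℝ) := fun ω => (Z ω, fun i => V i ω) with hTdef
  have hρ : IsGaussian (P.map T) := hZV.isGaussian_map
  have hlik (ω : Ω) : ∏ i, gaussianPDF (V i ω) v (y i) =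
      ENNReal.ofReal (noisePDF v (y - (T ω).2)) := by
    rw [noisePDF, ENNReal.ofReal_prod_of_nonneg fun _ _ => gaussianPDFReal_nonneg _ _ _]
    refine Finset.prod_congr rfl fun i _ => ?_
    rw [gaussianPDF, hTdef, Pi.sub_apply, gaussianPDFReal_sub, zero_add]
  have hcov (f g : ℝ × (ι → ℝ) → ℝ) (hf : Continuous f) (hg : Continuous g) :
      cov[f, g; P.map T] = cov[fun ω => f (T ω), fun ω => g (T ω); P] :=
    covariance_map_fun hf.aestronglyMeasurable hg.aestronglyMeasurable hT
  have hc1 (i j : ι) : cov[fun p => p.2 i, fun p => p.2 j; P.map T] = cov[V i, V j; P] :=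
    hcov _ _ (by fun_prop) (by fun_prop)
  have hc2 (j : ι) : cov[fun p => p.1, fun p => p.2 j; P.map T] = cov[Z, V j; P] :=
    hcov _ _ (by fun_prop) (by fun_prop)
  have hvar : Var[fun p => p.1; P.map T] = Var[Z; P] := by
    rw [variance_map (by fun_prop) hT]
    rfl
  have ha' : NormalEquations v (P.map T) a := fun j => by simp_rw [hc1, hc2]; exact ha j
  have h1 : ∫ p, p.1 ∂P.map T = 0 := by
    rw [integral_map hT (by fun_prop)]; exact hZ
  have h2 (i : ι) : ∫ p, p.2 i ∂P.map T = 0 := by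
    rw [integral_map hT (Continuous.aestronglyMeasurable (by fun_prop))]; exact hV i
  have key := map_fst_conditioned_eq_gaussianReal ha' hv h1 h2 y
  simp_rw [hc2, hvar] at key
  rw [← key, ← map_withDensity_comp hT (by fun_prop), lintegral_map' (by fun_prop) hT,
    ← Measure.map_smul, AEMeasurable.map_map_of_aemeasurable (by fun_prop)]
  · simp_rw [hlik]
    rfl
  · exact (hT.mono_ac (withDensity_absolutelyContinuous _ _)).smul_measure _

end Conditioning

/-! ### Gaussian tail bounds -/

section Tail

/-- The standard density at y + d equals exp(-d²/2) exp(-yd) times the density at y, and exp(-yd) ≤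
1 where yd ≥ 0. -/
lemma gaussianReal_shift_le {d : ℝ} {s s₀ : Set ℝ} (hs : MeasurableSet s) (hs₀ : MeasurableSet s₀)
    (h : ∀ y, y + d ∈ s → y ∈ s₀ ∧ 0 ≤ y * d) :
    gaussianReal 0 1 s ≤ ENNReal.ofReal (Real.exp (-d ^ 2 / 2)) * gaussianReal 0 1 s₀ := by
  rw [gaussianReal_apply _ one_ne_zero, gaussianReal_apply _ one_ne_zero, ← lintegral_indicator hs,
    ← lintegral_indicator hs₀, ← lintegral_const_mul _ ((measurable_gaussianPDF 0 1).indicator hs₀),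
    ← lintegral_add_right_eq_self _ d]
  refine lintegral_mono fun y => ?_
  by_cases hy : y + d ∈ s
  · obtain ⟨hy0, hyd⟩ := h y hy
    simp only [Set.indicator_of_mem hy, Set.indicator_of_mem hy0, gaussianPDF]
    rw [← ENNReal.ofReal_mul (Real.exp_pos _).le]
    refine ENNReal.ofReal_le_ofReal ?_
    simp only [gaussianPDFReal, NNReal.coe_one, mul_one, sub_zero]
    rw [mul_left_comm, ← Real.exp_add]
    gcongr
    nlinarith
  · simp [Set.indicator_of_notMem hy]

lemma gaussianReal_zero_one_tail_le {c : ℝ} (hc : 0 ≤ c) :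
    gaussianReal 0 1 {z | c < |z|} ≤ ENNReal.ofReal (Real.exp (-c ^ 2 / 2)) := by
  have hset : {z : ℝ | c < |z|} = Set.Ioi c ∪ Set.Iio (-c) := by
    ext z
    simp only [Set.mem_ofPred_eq, Set.mem_union, Set.mem_Ioi, Set.mem_Iio, lt_abs]
    constructor <;> rintro (h | h) <;> [left; right; left; right] <;> linarith
  have h1 := gaussianReal_shift_le (d := c) (s := Set.Ioi c) (s₀ := Set.Ioi 0) measurableSet_Ioi
    measurableSet_Ioi fun y hy => by
      simp only [Set.mem_Ioi, lt_add_iff_pos_left] at hy ⊢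
      exact ⟨hy, by positivity⟩
  have h2 := gaussianReal_shift_le (d := -c) (s := Set.Iio (-c)) (s₀ := Set.Iio 0)
    measurableSet_Iio measurableSet_Iio fun y hy => by
      simp only [Set.mem_Iio, add_lt_iff_neg_right] at hy ⊢
      exact ⟨hy, by nlinarith⟩
  rw [neg_sq] at h2
  calc gaussianReal 0 1 {z | c < |z|}
      ≤ gaussianReal 0 1 (Set.Ioi c) + gaussianReal 0 1 (Set.Iio (-c)) := by
        rw [hset]; exact measure_union_le _ _
    _ ≤ ENNReal.ofReal (Real.exp (-c ^ 2 / 2)) *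
        (gaussianReal 0 1 (Set.Ioi 0) + gaussianReal 0 1 (Set.Iio 0)) := by
        rw [mul_add]; exact add_le_add h1 h2
    _ ≤ ENNReal.ofReal (Real.exp (-c ^ 2 / 2)) * 1 := by
        gcongr
        -- Each tail is compared with its own half-line; these are disjoint, so the bound carries no
        -- factor 2.
        rw [← measure_union (μ := gaussianReal 0 1) (s₁ := Set.Ioi 0) (s₂ := Set.Iio 0) (Set.disjoint_left.2 fun x (h : 0 < x) (h' : x < 0) => h.not_gt h')
          measurableSet_Iio]
        exact prob_le_one
    _ = _ := mul_one _

/-- Two-sided Gaussian tail bound. -/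
lemma gaussianReal_tail_le (m : ℝ) (v : ℝ≥0) {c : ℝ} (hc : 0 ≤ c) :
    gaussianReal m v {z | c * √v < |z - m|} ≤ ENNReal.ofReal (Real.exp (-c ^ 2 / 2)) := by
  -- Writing the law as an affine image of the standard one also covers the degenerate case `v = 0`.
  have hmap : gaussianReal m v = (gaussianReal 0 1).map (fun z => √v * z + m) := by
    have h1 := gaussianReal_map_const_mul (μ := 0) (v := 1) (√v)
    have h2 := gaussianReal_map_add_const (μ := √v * 0)
      (v := NNReal.mk (√(v : ℝ) ^ 2) (sq_nonneg _) * 1) m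
    rw [← h1, Measure.map_map (by fun_prop) (by fun_prop)] at h2
    rw [show (fun z => √v * z + m) = (fun z => z + m) ∘ (fun z => √(v : ℝ) * z) from rfl, h2]
    congr 1
    · simp
    · ext
      simp
  rw [hmap, Measure.map_apply (by fun_prop) (measurableSet_lt (by fun_prop) (by fun_prop))]
  refine (measure_mono fun z hz => ?_).trans (gaussianReal_zero_one_tail_le hc)
  simp only [Set.mem_preimage, Set.mem_ofPred_eq, add_sub_cancel_right, abs_mul,
    abs_of_nonneg (Real.sqrt_nonneg _)] at hz ⊢
  rw [mul_comm] at hz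
  exact lt_of_mul_lt_mul_left hz (Real.sqrt_nonneg _)

end Tail

/-! ### Posterior laws of the unknown functions at a point -/

namespace Setup

variable {n N : ℕ} (S : Setup n N) {Ω : Type*} [MeasurableSpace Ω] {P : Measure Ω}
    {F G : State n → Ω → ℝ}

/-- The noiseless outputs as random variables. -/
def output (F G : State n → Ω → ℝ) (i : Fin N) (ω : Ω) : ℝ :=
  F (S.D.x i) ω + G (S.D.x i) ω * S.D.u i

section Prior

lemma memLp_of_isCenteredGP {k : State n → State n → ℝ} {F : State n → Ω → ℝ}
    (hF : IsCenteredGP F k P) (x : State n) : MemLp (F x) 2 P :=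
  (hF.isGaussianProcess.hasGaussianLaw_eval x).memLp_two

variable {S}

/-- Independence of the two processes makes their values at finitely many points jointly Gaussian,
and the outputs are linear in these values. -/
lemma hasGaussianLaw_prior (hF : IsCenteredGP F S.kf P) (hG : IsCenteredGP G S.kg P)
    (hFG : IndepFun (fun ω x => F x ω) (fun ω x => G x ω) P) (x : State n) :
    HasGaussianLaw (fun ω => (F x ω, fun i => S.output F G i ω)) P ∧
      HasGaussianLaw (fun ω => (G x ω, fun i => S.output F G i ω)) P := by
  classical
  let I : Finset (State n) := insert x (Finset.univ.image S.D.x)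
  have hx : x ∈ I := Finset.mem_insert_self _ _
  have hD (i : Fin N) : S.D.x i ∈ I :=
    Finset.mem_insert_of_mem (Finset.mem_image_of_mem _ (Finset.mem_univ _))
  have hr : Measurable (fun (h : State n → ℝ) => I.restrict h) := by
    fun_prop
  have hind : IndepFun (fun ω => I.restrict (F · ω)) (fun ω => I.restrict (G · ω)) P :=
    hFG.comp hr hr
  have hjoint := hind.hasGaussianLaw (hF.isGaussianProcess.hasGaussianLaw I)
    (hG.isGaussianProcess.hasGaussianLaw I)
  let O : ((I → ℝ) × (I → ℝ)) →ₗ[ℝ] (Fin N → ℝ) :=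
    { toFun := fun p i => p.1 ⟨S.D.x i, hD i⟩ + p.2 ⟨S.D.x i, hD i⟩ * S.D.u i
      map_add' := fun p q => by ext; simp; ring
      map_smul' := fun c p => by ext; simp; ring }
  constructor
  · exact hjoint.map (LinearMap.toContinuousLinearMap
      ((LinearMap.proj (⟨x, hx⟩ : I) ∘ₗ LinearMap.fst ℝ (I → ℝ) (I → ℝ)).prod O))
  · exact hjoint.map (LinearMap.toContinuousLinearMap
      ((LinearMap.proj (⟨x, hx⟩ : I) ∘ₗ LinearMap.snd ℝ (I → ℝ) (I → ℝ)).prod O))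

lemma memLp_output (hF : IsCenteredGP F S.kf P) (hG : IsCenteredGP G S.kg P) (i : Fin N) :
    MemLp (S.output F G i) 2 P :=
  (memLp_of_isCenteredGP hF _).add ((memLp_of_isCenteredGP hG _).mul_const _)

lemma covariance_prior (hF : IsCenteredGP F S.kf P) (hG : IsCenteredGP G S.kg P)
    (hFG : IndepFun (fun ω x => F x ω) (fun ω x => G x ω) P) (x x' : State n) :
    cov[F x, G x'; P] = 0 :=
  IndepFun.covariance_eq_zero (hFG.comp (measurable_pi_apply x) (measurable_pi_apply x'))
    (memLp_of_isCenteredGP hF _) (memLp_of_isCenteredGP hG _)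

variable [IsProbabilityMeasure P]

lemma integral_output (hF : IsCenteredGP F S.kf P) (hG : IsCenteredGP G S.kg P) (i : Fin N) :
    ∫ ω, S.output F G i ω ∂P = 0 := by
  unfold output
  rw [integral_add ((memLp_of_isCenteredGP hF _).integrable one_le_two)
    (((memLp_of_isCenteredGP hG _).integrable one_le_two).mul_const _), integral_mul_const,
    hF.mean_eq_zero, hG.mean_eq_zero]
  simp

lemma covariance_output_right {Z : Ω → ℝ} (hZ : MemLp Z 2 P) (hF : IsCenteredGP F S.kf P)
    (hG : IsCenteredGP G S.kg P) (j : Fin N) :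
    cov[Z, S.output F G j; P] = cov[Z, F (S.D.x j); P] + cov[Z, G (S.D.x j); P] * S.D.u j := by
  rw [show S.output F G j = F (S.D.x j) + fun ω => G (S.D.x j) ω * S.D.u j from rfl,
    covariance_add_right hZ (memLp_of_isCenteredGP hF _)
      ((memLp_of_isCenteredGP hG _).mul_const _), covariance_mul_const_right]

lemma covariance_fst_output (hF : IsCenteredGP F S.kf P) (hG : IsCenteredGP G S.kg P)
    (hFG : IndepFun (fun ω x => F x ω) (fun ω x => G x ω) P) (x : State n) (j : Fin N) :
    cov[F x, S.output F G j; P] = S.kvecf x j := by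
  rw [covariance_output_right (memLp_of_isCenteredGP hF _) hF hG, hF.covariance_eq,
    covariance_prior hF hG hFG, kvecf]
  ring

lemma covariance_snd_output (hF : IsCenteredGP F S.kf P) (hG : IsCenteredGP G S.kg P)
    (hFG : IndepFun (fun ω x => F x ω) (fun ω x => G x ω) P) (x : State n) (j : Fin N) :
    cov[G x, S.output F G j; P] = S.kvecg x j := by
  rw [covariance_output_right (memLp_of_isCenteredGP hG _) hF hG, hG.covariance_eq,
    covariance_comm, covariance_prior hF hG hFG, kvecg, Matrix.mulVec_diagonal]
  ring

lemma covariance_output_output (hF : IsCenteredGP F S.kf P) (hG : IsCenteredGP G S.kg P)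
    (hFG : IndepFun (fun ω x => F x ω) (fun ω x => G x ω) P) (i j : Fin N) :
    cov[S.output F G i, S.output F G j; P] = S.gram i j := by
  rw [covariance_output_right (memLp_output hF hG _) hF hG, covariance_comm,
    covariance_output_right (memLp_of_isCenteredGP hF _) hF hG,
    covariance_comm (S.output F G i) (G _),
    covariance_output_right (memLp_of_isCenteredGP hG _) hF hG, covariance_prior hF hG hFG,
    covariance_comm (G _) (F _), covariance_prior hF hG hFG, covariance_comm (F _) (F _),
    covariance_comm (G _) (G _), hF.covariance_eq, hG.covariance_eq, gram, Matrix.of_apply]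
  ring

/-- The Gram matrix is the covariance matrix of the noiseless outputs, so its positivity comes from
the existence of the processes and need not be assumed of the kernels. -/
lemma posSemidef_gram (hF : IsCenteredGP F S.kf P) (hG : IsCenteredGP G S.kg P)
    (hFG : IndepFun (fun ω x => F x ω) (fun ω x => G x ω) P) : S.gram.PosSemidef := by
  refine Matrix.PosSemidef.of_dotProduct_mulVec_nonneg ?_ fun c => ?_
  · ext i j
    rw [Matrix.conjTranspose_apply, ← covariance_output_output hF hG hFG,
      ← covariance_output_output hF hG hFG, covariance_comm]
    rfl
  · have hm (i : Fin N) : MemLp (fun ω => c i * S.output F G i ω) 2 P :=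
      (memLp_output hF hG i).const_mul _
    have h := variance_nonneg (fun ω => ∑ i, c i * S.output F G i ω) P
    rw [← covariance_self (memLp_finsetSum _ fun i _ => hm i).aestronglyMeasurable.aemeasurable,
      covariance_fun_sum_fun_sum hm hm] at h
    simp_rw [covariance_const_mul_left, covariance_const_mul_right,
      covariance_output_output hF hG hFG] at h
    refine h.trans_eq ?_
    simp only [dotProduct, Matrix.mulVec, Pi.star_apply, star_trivial, Finset.mul_sum]
    exact Finset.sum_congr rfl fun i _ => Finset.sum_congr rfl fun j _ => by ring

lemma invGram_mul (hσ : 0 < S.σon) (hF : IsCenteredGP F S.kf P) (hG : IsCenteredGP G S.kg P)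
    (hFG : IndepFun (fun ω x => F x ω) (fun ω x => G x ω) P) :
    S.invGram * (S.gram + ((S.σon : ℝ) ^ 2) • 1) = 1 := by
  have h : (S.gram + ((S.σon : ℝ) ^ 2) • (1 : Matrix (Fin N) (Fin N) ℝ)).PosDef :=
    Matrix.PosDef.posSemidef_add (posSemidef_gram hF hG hFG)
      (Matrix.PosDef.one.smul (by positivity))
  exact Matrix.nonsing_inv_mul _ ((Matrix.isUnit_iff_isUnit_det _).1 h.isUnit)

/-- Law under the posterior of a variable that is jointly Gaussian with the outputs. -/
lemma map_posterior (hσ : 0 < S.σon) (hF : IsCenteredGP F S.kf P) (hG : IsCenteredGP G S.kg P)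
    (hFG : IndepFun (fun ω x => F x ω) (fun ω x => G x ω) P) {Z : Ω → ℝ}
    (hZ : HasGaussianLaw (fun ω => (Z ω, fun i => S.output F G i ω)) P) (hZ0 : ∫ ω, Z ω ∂P = 0)
    {k : Fin N → ℝ} (hk : ∀ j, cov[Z, S.output F G j; P] = k j) :
    (posterior P F G S.D S.σon).map Z = gaussianReal (k ⬝ᵥ Matrix.mulVec S.invGram S.D.y)
      (Var[Z; P] - k ⬝ᵥ Matrix.mulVec S.invGram k).toNNReal := by
  -- The coefficients kᵀM solve the normal equations because M inverts K + σ²I.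
  have h := map_posterior_eq_gaussianReal (v := S.σon ^ 2) (a := Matrix.vecMul k S.invGram) hZ hZ0
    (integral_output hF hG) (by positivity) (fun j => ?_) S.D.y
  · simp_rw [hk] at h
    rw [Matrix.dotProduct_mulVec, Matrix.dotProduct_mulVec]
    exact h
  · have := congrFun (congrArg (Matrix.vecMul k) (invGram_mul hσ hF hG hFG)) j
    rw [← Matrix.vecMul_vecMul, Matrix.vecMul_one, Matrix.vecMul, dotProduct] at this
    rw [hk, ← this]
    refine Finset.sum_congr rfl fun i _ => ?_
    rw [covariance_output_output hF hG hFG]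
    simp [Matrix.one_apply]

lemma posterior_absolutelyContinuous {P : Measure Ω} (D : Dataset n N) (σ : ℝ≥0) :
    posterior P F G D σ ≪ P :=
  (Measure.smul_absolutelyContinuous).trans (withDensity_absolutelyContinuous _ _)

lemma posterior_tail (hσ : 0 < S.σon) (hF : IsCenteredGP F S.kf P) (hG : IsCenteredGP G S.kg P)
    (hFG : IndepFun (fun ω x => F x ω) (fun ω x => G x ω) P) {Z : Ω → ℝ}
    (hZ : HasGaussianLaw (fun ω => (Z ω, fun i => S.output F G i ω)) P) (hZ0 : ∫ ω, Z ω ∂P = 0)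
    {k : Fin N → ℝ} (hk : ∀ j, cov[Z, S.output F G j; P] = k j) {c : ℝ} (hc : 0 ≤ c) :
    posterior P F G S.D S.σon {ω | c * √(cov[Z, Z; P] - k ⬝ᵥ Matrix.mulVec S.invGram k) <
        |Z ω - k ⬝ᵥ Matrix.mulVec S.invGram S.D.y|} ≤ ENNReal.ofReal (Real.exp (-c ^ 2 / 2)) := by
  have hZm : AEMeasurable Z P := hZ.fst.aemeasurable
  have ht := gaussianReal_tail_le (k ⬝ᵥ Matrix.mulVec S.invGram S.D.y)
    (Var[Z; P] - k ⬝ᵥ Matrix.mulVec S.invGram k).toNNReal hc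
  rw [← map_posterior hσ hF hG hFG hZ hZ0 hk, Measure.map_apply_of_aemeasurable
    (hZm.mono_ac (posterior_absolutelyContinuous _ _))
    (measurableSet_lt (by fun_prop) (by fun_prop)), ← covariance_self hZm, Real.coe_toNNReal']
    at ht
  -- Truncation at zero in `toNNReal` agrees with the convention that the square root of a negative
  -- number is 0.
  have hmax (r : ℝ) : √(max r 0) = √r := by
    rcases le_total r 0 with h | h
    · rw [max_eq_right h, Real.sqrt_zero, Real.sqrt_eq_zero_of_nonpos h]
    · rw [max_eq_left h]
  rwa [hmax] at ht

lemma posterior_tail_f (hσ : 0 < S.σon) (hF : IsCenteredGP F S.kf P) (hG : IsCenteredGP G S.kg P)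
    (hFG : IndepFun (fun ω x => F x ω) (fun ω x => G x ω) P) (x : State n) {c : ℝ} (hc : 0 ≤ c) :
    posterior P F G S.D S.σon {ω | c * S.σf x < |F x ω - S.μf x|} ≤
      ENNReal.ofReal (Real.exp (-c ^ 2 / 2)) := by
  have h := posterior_tail hσ hF hG hFG (hasGaussianLaw_prior hF hG hFG x).1 (hF.mean_eq_zero x)
    (covariance_fst_output hF hG hFG x) hc
  rwa [hF.covariance_eq] at h

lemma posterior_tail_g (hσ : 0 < S.σon) (hF : IsCenteredGP F S.kf P) (hG : IsCenteredGP G S.kg P)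
    (hFG : IndepFun (fun ω x => F x ω) (fun ω x => G x ω) P) (x : State n) {c : ℝ} (hc : 0 ≤ c) :
    posterior P F G S.D S.σon {ω | c * S.σg x < |G x ω - S.μg x|} ≤
      ENNReal.ofReal (Real.exp (-c ^ 2 / 2)) := by
  have h := posterior_tail hσ hF hG hFG (hasGaussianLaw_prior hF hG hFG x).2 (hG.mean_eq_zero x)
    (covariance_snd_output hF hG hFG x) hc
  rwa [hG.covariance_eq] at h

/-- The posterior is a probability measure: the evidence of the data is positive and finite. -/
lemma isProbabilityMeasure_posterior (hσ : 0 < S.σon) (hF : IsCenteredGP F S.kf P)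
    (hG : IsCenteredGP G S.kg P) (hFG : IndepFun (fun ω x => F x ω) (fun ω x => G x ω) P) :
    IsProbabilityMeasure (posterior P F G S.D S.σon) := by
  have h := map_posterior hσ hF hG hFG (hasGaussianLaw_prior hF hG hFG 0).1 (hF.mean_eq_zero 0)
    (covariance_fst_output hF hG hFG 0)
  have hm : AEMeasurable (F 0) (posterior P F G S.D S.σon) :=
    (hF.isGaussianProcess.aemeasurable 0).mono_ac (posterior_absolutelyContinuous _ _)
  -- A pushforward preserves total mass, and that of `F 0` is Gaussian.
  exact (Measure.isProbabilityMeasure_map_iff hm).1 (h ▸ inferInstance)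

end Prior

end Setup

/-! ### Finite coverings and uniform error bounds -/

section Covering

/-- In a finite-dimensional space the convex hull of a compact set is compact. -/
lemma isCompact_convexHull {E : Type*} [NormedAddCommGroup E] [NormedSpace ℝ E]
    [FiniteDimensional ℝ E] {s : Set E} (hs : IsCompact s) : IsCompact (convexHull ℝ s) := by
  rcases s.eq_empty_or_nonempty with rfl | ⟨x₀, hx₀⟩
  · simp
  -- Carathéodory: dimension + 1 points suffice, so the hull is a continuous image of a compact set.
  -- Shorter combinations are padded with zero weights at `x₀`.
  set m := Module.finrank ℝ E + 1
  have hc : IsCompact ((fun p : (Fin m → ℝ) × (Fin m → E) => ∑ i, p.1 i • p.2 i) ''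
      (stdSimplex ℝ (Fin m) ×ˢ Set.univ.pi fun _ => s)) :=
    ((isCompact_stdSimplex ℝ (Fin m)).prod (isCompact_univ_pi fun _ => hs)).image (by fun_prop)
  convert hc
  refine Set.Subset.antisymm (fun x hx => ?_) ?_
  · obtain ⟨ι, hι, z, w, hz, haff, hw, hw1, rfl⟩ := eq_pos_convex_span_of_mem_convexHull hx
    have hcard : Fintype.card ι ≤ Fintype.card (Fin m) := by
      rw [Fintype.card_fin]
      exact haff.card_le_finrank_succ.trans (Nat.succ_le_succ (Submodule.finrank_le _))
    obtain ⟨φ⟩ := Function.Embedding.nonempty_of_card_le hcard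
    refine ⟨(Function.extend φ w 0, Function.extend φ z fun _ => x₀), ⟨⟨fun i => ?_, ?_⟩,
      fun i _ => ?_⟩, ?_⟩
    · by_cases h : ∃ j, φ j = i
      · obtain ⟨j, rfl⟩ := h
        simp only [φ.injective.extend_apply]
        exact (hw j).le
      · simp only [Function.extend_apply' _ _ _ h]; rfl
    · rw [← hw1]
      refine (Fintype.sum_of_injective φ φ.injective _ _ (fun i hi => ?_) fun j => ?_).symm
      · exact Function.extend_apply' _ _ _ hi
      · exact (φ.injective.extend_apply _ _ _).symm
    · by_cases h : ∃ j, φ j = i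
      · obtain ⟨j, rfl⟩ := h
        simp only [φ.injective.extend_apply]
        exact hz ⟨j, rfl⟩
      · simp only [Function.extend_apply' _ _ _ h]; exact hx₀
    · refine (Fintype.sum_of_injective φ φ.injective _ _ (fun i hi => ?_) fun j => ?_).symm
      · simp only [Function.extend_apply' (f := φ) _ _ _ hi, Pi.zero_apply, zero_smul]
      · simp only [φ.injective.extend_apply]
  · rintro _ ⟨⟨w, z⟩, ⟨⟨hw, hw1⟩, hz⟩, rfl⟩
    exact mem_convexHull_of_exists_fintype w z hw hw1 (fun i => hz i trivial) rfl

/-- Projection onto a compact convex set does not increase the distance to its points. -/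
lemma exists_dist_le_of_convex {E : Type*} [NormedAddCommGroup E] [InnerProductSpace ℝ E]
    {K : Set E} (hK : IsCompact K) (hne : K.Nonempty) (hconv : Convex ℝ K) (c : E) :
    ∃ p ∈ K, ∀ x ∈ K, dist x p ≤ dist x c := by
  obtain ⟨p, hp, hpc⟩ := exists_norm_eq_iInf_of_complete_convex hne hK.isComplete hconv c
  -- The variational inequality says that the angle at the projection `p` is obtuse.
  rw [norm_eq_iInf_iff_real_inner_le_zero hconv hp] at hpc
  refine ⟨p, hp, fun x hx => ?_⟩
  have h := hpc x hx
  rw [dist_eq_norm, dist_eq_norm]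
  refine le_of_sq_le_sq ?_ (norm_nonneg _)
  have e : x - c = (x - p) - (c - p) := by abel
  rw [e, norm_sub_sq_real (x - p) (c - p), real_inner_comm]
  nlinarith [sq_nonneg ‖c - p‖]

/-- Covering of a bounded set by the cells of a grid, with centres moved to the convex hull. -/
lemma exists_finset_cover {n : ℕ} {X : Set (State n)} (hX : IsCompact X) {τ : ℝ} (hτ : 0 < τ) :
    ∃ T : Finset (State n), ↑T ⊆ convexHull ℝ X ∧
      (T.card : ℝ) ≤ ∏ j : Fin n, (√n / (2 * τ) * (sSup ((fun x : State n => x j) '' X) -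
        sInf ((fun x : State n => x j) '' X)) + 1) ∧
      ∀ x ∈ X, ∃ p ∈ T, dist x p ≤ τ := by
  classical
  rcases X.eq_empty_or_nonempty with rfl | hne
  · exact ⟨∅, by simp, by simp, by simp⟩
  set lo : Fin n → ℝ := fun j => sInf ((fun x : State n => x j) '' X)
  set hi : Fin n → ℝ := fun j => sSup ((fun x : State n => x j) '' X)
  have himg (j : Fin n) : IsCompact ((fun x : State n => x j) '' X) := hX.image (by fun_prop)
  have hlo (x) (hx : x ∈ X) (j) : lo j ≤ x j := csInf_le (himg j).bddBelow ⟨x, hx, rfl⟩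
  have hhi (x) (hx : x ∈ X) (j) : x j ≤ hi j := le_csSup (himg j).bddAbove ⟨x, hx, rfl⟩
  -- `r` is the reciprocal of the cell side 2τ/√n, for which half the diagonal is τ.
  set r : ℝ := √n / (2 * τ)
  have hr : 0 ≤ r := by positivity
  have hw (j : Fin n) : 0 ≤ r * (hi j - lo j) := by
    obtain ⟨x, hx⟩ := hne
    exact mul_nonneg hr (sub_nonneg.2 ((hlo x hx j).trans (hhi x hx j)))
  have hconv := convex_convexHull ℝ X
  have hK := isCompact_convexHull hX
  -- A cell centre may lie outside the hull, where no Lipschitz bound is available; projecting it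
  -- keeps all points of `X` within τ.
  choose p hpK hp using exists_dist_le_of_convex hK hne.convexHull hconv
  set ctr : (Fin n → ℕ) → State n := fun k => WithLp.toLp 2 fun j => lo j + (k j + 1 / 2) / r
  set J := Fintype.piFinset fun j => Finset.range (⌊r * (hi j - lo j)⌋₊ + 1)
  refine ⟨J.image fun k => p (ctr k), ?_, ?_, fun x hx => ?_⟩
  · intro q hq
    obtain ⟨k, -, rfl⟩ := Finset.mem_image.1 (Finset.mem_coe.1 hq)
    exact hpK _
  · calc ((J.image fun k => p (ctr k)).card : ℝ) ≤ J.card := by exact_mod_cast Finset.card_image_le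
      _ = ∏ j : Fin n, ((⌊r * (hi j - lo j)⌋₊ : ℝ) + 1) := by
        rw [Fintype.card_piFinset]; push_cast [Finset.card_range]; rfl
      _ ≤ _ := Finset.prod_le_prod (fun _ _ => by positivity) fun j _ => by
        gcongr
        exact Nat.floor_le (hw j)
  · set k : Fin n → ℕ := fun j => ⌊r * (x j - lo j)⌋₊ with hk
    refine ⟨p (ctr k), Finset.mem_image_of_mem _ (Fintype.mem_piFinset.2 fun j => ?_),
      (hp _ x (subset_convexHull ℝ X hx)).trans ?_⟩
    · rw [Finset.mem_range, Nat.lt_succ_iff]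
      exact Nat.floor_le_floor (mul_le_mul_of_nonneg_left (by linarith [hhi x hx j]) hr)
    · rcases Nat.eq_zero_or_pos n with rfl | hn
      · rw [Subsingleton.elim x (ctr k), dist_self]; exact hτ.le
      have hn' : (0 : ℝ) < n := by exact_mod_cast hn
      have hr' : 0 < r := by positivity
      have hcoord (j : Fin n) : (x j - ctr k j) ^ 2 ≤ (τ / √n) ^ 2 := by
        rw [sq_le_sq, abs_of_nonneg (a := τ / √n) (by positivity)]
        have h0 : 0 ≤ r * (x j - lo j) := mul_nonneg hr (by linarith [hlo x hx j])
        have h1 := Nat.floor_le h0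
        have h2 := Nat.lt_floor_add_one (r * (x j - lo j))
        have e : x j - ctr k j = (r * (x j - lo j) - ⌊r * (x j - lo j)⌋₊ - 1 / 2) / r := by
          simp only [ctr, hk]
          field_simp
          ring
        have e2 : τ / √n = 1 / 2 / r := by
          simp only [r]
          field_simp
        rw [e, e2, abs_div, abs_of_pos hr']
        gcongr
        rw [abs_le]
        constructor <;> linarith
      rw [EuclideanSpace.dist_eq]
      refine Real.sqrt_le_iff.2 ⟨hτ.le, ?_⟩
      calc ∑ j, dist (x j) (ctr k j) ^ 2 ≤ ∑ _j : Fin n, (τ / √n) ^ 2 :=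
            Finset.sum_le_sum fun j _ => by rw [Real.dist_eq, sq_abs]; exact hcoord j
        _ = τ ^ 2 := by
            rw [Finset.sum_const, Finset.card_univ, Fintype.card_fin, nsmul_eq_mul, div_pow,
              Real.sq_sqrt hn'.le]
            field_simp

/-- Deterministic part of the error bound: a bound on a covering extends to the whole set. -/
lemma abs_sub_le_of_cover {E : Type*} [PseudoMetricSpace E] {K : Set E} {h μ σ : E → ℝ}
    {Lh Lμ Lσ : ℝ≥0} (hh : LipschitzOnWith Lh h K) (hμ : LipschitzOnWith Lμ μ K)
    (hσ : LipschitzOnWith Lσ σ K) {τ σlow B : ℝ} (hB : 4 ≤ B)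
    (hτ : ((Lh : ℝ) + Lμ + Lσ) * τ ≤ σlow) {x p : E} (hx : x ∈ K) (hp : p ∈ K)
    (hd : dist x p ≤ τ) (hpb : |h p - μ p| ≤ √B / 2 * σ p) :
    |h x - μ x| ≤ √B * max (σ x) σlow := by
  have h1 := abs_le.1 ((Real.dist_eq (h x) (h p)) ▸ (hh.dist_le_mul x hx p hp))
  have h2 := abs_le.1 ((Real.dist_eq (μ x) (μ p)) ▸ (hμ.dist_le_mul x hx p hp))
  have h3 := abs_le.1 ((Real.dist_eq (σ x) (σ p)) ▸ (hσ.dist_le_mul x hx p hp))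
  have h4 := abs_le.1 hpb
  have hsq : 2 ≤ √B := Real.le_sqrt_of_sq_le (by linarith)
  have hm1 := le_max_left (σ x) σlow
  have hm2 := le_max_right (σ x) σlow
  have a1 : (Lh : ℝ) * dist x p ≤ Lh * τ := by gcongr
  have a2 : (Lμ : ℝ) * dist x p ≤ Lμ * τ := by gcongr
  have a3 : (Lσ : ℝ) * dist x p ≤ Lσ * τ := by gcongr
  have b0 : 0 ≤ (Lh + Lμ : ℝ) * τ := by
    have := dist_nonneg.trans hd
    positivity
  have b1 : √B / 2 * σ p ≤ √B / 2 * (σ x + Lσ * τ) := by gcongr; linarith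
  -- Here √B ≥ 2 is needed: half of √B must absorb the variation of h and μ, which carries no factor
  -- √B, together with that of σ.
  have b2 : (Lh + Lμ : ℝ) * τ ≤ √B / 2 * ((Lh + Lμ) * τ) := by nlinarith
  have b3 : √B / 2 * (((Lh : ℝ) + Lμ + Lσ) * τ) ≤ √B / 2 * σlow := by gcongr
  have b4 : √B / 2 * σ x ≤ √B / 2 * max (σ x) σlow := by gcongr
  have b5 : √B / 2 * σlow ≤ √B / 2 * max (σ x) σlow := by gcongr
  rw [abs_le]
  constructor <;> nlinarith

/-- Uniform error bound for a random function on a compact set, from pointwise Gaussian tails. -/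
lemma exists_small_set_uniform_bound {n : ℕ} {Ω : Type*} [MeasurableSpace Ω] (m : Measure Ω)
    {X : Set (State n)} (hX : IsCompact X) {H : State n → Ω → ℝ} {μ σ : State n → ℝ}
    (htail : ∀ p, ∀ c, 0 ≤ c →
      m {ω | c * σ p < |H p ω - μ p|} ≤ ENNReal.ofReal (Real.exp (-c ^ 2 / 2)))
    {Lh Lμ Lσ : ℝ≥0} (hμ : LipschitzOnWith Lμ μ (convexHull ℝ X))
    (hσ : LipschitzOnWith Lσ σ (convexHull ℝ X)) {δ σlow β : ℝ} (hδ : δ ∈ Set.Ioo (0 : ℝ) 1)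
    (hσlow : 0 < σlow)
    (hβ : β = 8 * Real.log (2 / δ * ∏ j : Fin n, (√n / (2 * (σlow / (Lh + Lμ + Lσ))) *
      (sSup ((fun x : State n => x j) '' X) - sInf ((fun x : State n => x j) '' X)) + 1))) :
    ∃ B : Set Ω, m B ≤ ENNReal.ofReal (δ / 2) ∧
      ∀ ω ∉ B, LipschitzOnWith Lh (fun x => H x ω) (convexHull ℝ X) →
        ∀ x ∈ X, |H x ω - μ x| ≤ √β * max (σ x) σlow := by
  set L : ℝ := Lh + Lμ + Lσ with hL
  have hL0 : 0 ≤ L := by positivity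
  set w : Fin n → ℝ := fun j =>
    sSup ((fun x : State n => x j) '' X) - sInf ((fun x : State n => x j) '' X) with hw
  have hw0 (j) : 0 ≤ w j := by
    have himg : IsCompact ((fun x : State n => x j) '' X) := hX.image (by fun_prop)
    exact sub_nonneg.2 (Real.sInf_le_sSup _ himg.bddBelow himg.bddAbove)
  set M : ℝ := ∏ j : Fin n, (√n / (2 * (σlow / L)) * w j + 1) with hM
  have hM1 : 1 ≤ M := Finset.one_le_prod fun j => by
    have := hw0 j
    have : 0 ≤ √n / (2 * (σlow / L)) * w j := by positivity
    simpa using this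
  -- The form `L * dist x p ≤ σlow` also makes sense for `L = 0`, where one point suffices and
  -- division by zero gives `M = 1`.
  obtain ⟨T, hTK, hcard, hT⟩ : ∃ T : Finset (State n), ↑T ⊆ convexHull ℝ X ∧ (T.card : ℝ) ≤ M ∧
      ∀ x ∈ X, ∃ p ∈ T, L * dist x p ≤ σlow := by
    rcases hL0.eq_or_lt with h0 | hpos
    · rcases X.eq_empty_or_nonempty with rfl | ⟨x₀, hx₀⟩
      · exact ⟨∅, by simp, by simpa using zero_le_one.trans hM1, by simp⟩
      · refine ⟨{x₀}, by simpa using subset_convexHull ℝ X hx₀, by simpa using hM1, fun x _ =>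
          ⟨x₀, by simp, ?_⟩⟩
        rw [← h0, zero_mul]
        exact hσlow.le
    · obtain ⟨T, h1, h2, h3⟩ := exists_finset_cover hX (div_pos hσlow hpos)
      refine ⟨T, h1, h2, fun x hx => ?_⟩
      obtain ⟨p, hp, hd⟩ := h3 x hx
      exact ⟨p, hp, by rwa [le_div_iff₀ hpos, mul_comm] at hd⟩
  have hδ0 := hδ.1
  have harg : 0 < 2 / δ * M := by positivity
  have h2arg : 2 ≤ 2 / δ * M := by
    have : 2 ≤ 2 / δ := by rw [le_div_iff₀ hδ0]; linarith [hδ.2]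
    nlinarith
  have hβ4 : 4 ≤ β := by
    have h1 := Real.log_le_log two_pos h2arg
    have h2 := Real.log_two_gt_d9
    rw [hβ]
    linarith
  -- The covering points are tested at level √β/2, whose tail is exp(-β/8); the factor 8 in β makes
  -- this δ/(2M), so at most M points cost δ/2.
  have hexp : Real.exp (-(√β / 2) ^ 2 / 2) = δ / 2 / M := by
    rw [div_pow, Real.sq_sqrt (by linarith), hβ]
    rw [show -(8 * Real.log (2 / δ * M) / 2 ^ 2) / 2 = -Real.log (2 / δ * M) by ring,
      Real.exp_neg, Real.exp_log harg]
    field_simp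
  refine ⟨⋃ p ∈ T, {ω | √β / 2 * σ p < |H p ω - μ p|}, ?_, fun ω hω hlip x hx => ?_⟩
  · calc m (⋃ p ∈ T, {ω | √β / 2 * σ p < |H p ω - μ p|})
        ≤ ∑ p ∈ T, m {ω | √β / 2 * σ p < |H p ω - μ p|} := measure_biUnion_finset_le _ _
      _ ≤ ∑ _p ∈ T, ENNReal.ofReal (δ / 2 / M) := by
        refine Finset.sum_le_sum fun p _ => ?_
        rw [← hexp]
        exact htail p _ (by positivity)
      _ = ENNReal.ofReal (T.card * (δ / 2 / M)) := by
        rw [Finset.sum_const, nsmul_eq_mul, ENNReal.ofReal_mul (by positivity),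
          ENNReal.ofReal_natCast]
      _ ≤ _ := by
        refine ENNReal.ofReal_le_ofReal ?_
        calc T.card * (δ / 2 / M) ≤ M * (δ / 2 / M) := by gcongr
          _ = δ / 2 := by field_simp
  · obtain ⟨p, hp, hd⟩ := hT x hx
    simp only [Set.mem_iUnion, not_exists, Set.mem_ofPred_eq, not_lt] at hω
    exact abs_sub_le_of_cover hlip hμ hσ hβ4 hd (subset_convexHull ℝ X hx) (hTK hp) le_rfl
      (hω p hp)

end Covering

/-! ### The high-probability event -/

namespace Setup

/-- With posterior probability at least `1 - δ` the posterior standard deviations bound the errors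
of the posterior means uniformly on the domain. -/
lemma exists_event_uniform_bound {n N : ℕ} (S : Setup n N) {Ω : Type*} [MeasurableSpace Ω]
    {P : Measure Ω} [IsProbabilityMeasure P] {F G : State n → Ω → ℝ}
    (hF : IsCenteredGP F S.kf P) (hG : IsCenteredGP G S.kg P)
    (hFG : IndepFun (fun ω x => F x ω) (fun ω x => G x ω) P) (hσon : 0 < S.σon)
    (hX : IsCompact S.X) (hδ : S.δ ∈ Set.Ioo (0 : ℝ) 1) (hσlowf : 0 < S.σlowf)
    (hσlowg : 0 < S.σlowg)
    (hμf : LipschitzOnWith S.Lμf S.μf (convexHull ℝ S.X))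
    (hμg : LipschitzOnWith S.Lμg S.μg (convexHull ℝ S.X))
    (hσf : LipschitzOnWith S.Lσf S.σf (convexHull ℝ S.X))
    (hσg : LipschitzOnWith S.Lσg S.σg (convexHull ℝ S.X)) :
    ∃ E : Set Ω, MeasurableSet E ∧ ENNReal.ofReal (1 - S.δ) ≤ posterior P F G S.D S.σon E ∧
      ∀ ω ∈ E, S.Admissible (fun x => F x ω) (fun x => G x ω) → ∀ x ∈ S.X,
        |F x ω - S.μf x| ≤ √S.βf * S.σtf x ∧ |G x ω - S.μg x| ≤ √S.βg * S.σtg x := by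
  have hprob := isProbabilityMeasure_posterior hσon hF hG hFG
  obtain ⟨Bf, hBf, hf⟩ := exists_small_set_uniform_bound (β := S.βf) (Lh := S.Lf) _ hX
    (fun p c hc => posterior_tail_f hσon hF hG hFG p hc) hμf hσf hδ hσlowf rfl
  obtain ⟨Bg, hBg, hg⟩ := exists_small_set_uniform_bound (β := S.βg) (Lh := S.Lg) _ hX
    (fun p c hc => posterior_tail_g hσon hF hG hFG p hc) hμg hσg hδ hσlowg rfl
  set m := posterior P F G S.D S.σon
  -- The bad set need not be measurable, so it is replaced by a measurable hull of the same measure.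
  refine ⟨(toMeasurable m (Bf ∪ Bg))ᶜ, (measurableSet_toMeasurable _ _).compl, ?_,
    fun ω hω hadm x hx => ?_⟩
  · rw [prob_compl_eq_one_sub (measurableSet_toMeasurable _ _), measure_toMeasurable,
      ENNReal.ofReal_sub _ hδ.1.le, ENNReal.ofReal_one]
    refine tsub_le_tsub_left ((measure_union_le _ _).trans ((add_le_add hBf hBg).trans_eq ?_)) _
    have := hδ.1
    rw [← ENNReal.ofReal_add (by positivity) (by positivity), add_halves]
  · have hω' : ω ∉ Bf ∪ Bg := fun h => hω (subset_toMeasurable _ _ h)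
    exact ⟨hf ω (fun h => hω' (Or.inl h)) hadm.lipschitz_f x hx,
      hg ω (fun h => hω' (Or.inr h)) hadm.lipschitz_g x hx⟩

end Setup

/-! ### Local Lipschitz continuity -/

section LipschitzNear

variable {E F G : Type*} [PseudoMetricSpace E] [PseudoMetricSpace F] [PseudoMetricSpace G]

/-- `f` is Lipschitz on a neighbourhood of `x` within `s`. -/
def LipschitzNear (s : Set E) (f : E → F) (x : E) : Prop :=
  ∃ K : ℝ≥0, ∃ t ∈ 𝓝[s] x, LipschitzOnWith K f t

namespace LipschitzNear

variable {s : Set E} {x : E}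

lemma continuousWithinAt {f : E → F} (hf : LipschitzNear s f x) (hx : x ∈ s) :
    ContinuousWithinAt f s x := by
  obtain ⟨K, t, ht, hK⟩ := hf
  exact (hK.continuousOn x (mem_of_mem_nhdsWithin hx ht)).mono_of_mem_nhdsWithin ht

lemma congr {f g : E → F} (hf : LipschitzNear s f x) (h : f =ᶠ[𝓝[s] x] g) :
    LipschitzNear s g x := by
  obtain ⟨K, t, ht, hK⟩ := hf
  refine ⟨K, t ∩ {y | f y = g y}, inter_mem ht h, fun y hy z hz => ?_⟩
  have hy' : f y = g y := hy.2
  have hz' : f z = g z := hz.2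
  rw [← hy', ← hz']
  exact hK hy.1 hz.1

lemma comp {f : E → F} {g : F → G} (hg : LipschitzNear Set.univ g (f x))
    (hf : LipschitzNear s f x) (hx : x ∈ s) : LipschitzNear s (fun y => g (f y)) x := by
  have hc := hf.continuousWithinAt hx
  obtain ⟨K, t, ht, hK⟩ := hf
  obtain ⟨K', t', ht', hK'⟩ := hg
  rw [nhdsWithin_univ] at ht'
  exact ⟨K' * K, t ∩ f ⁻¹' t', inter_mem ht (hc ht'),
    hK'.comp (hK.mono Set.inter_subset_left) fun y hy => hy.2⟩

lemma prodMk {f : E → F} {g : E → G} (hf : LipschitzNear s f x) (hg : LipschitzNear s g x) :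
    LipschitzNear s (fun y => (f y, g y)) x := by
  obtain ⟨K, t, ht, hK⟩ := hf
  obtain ⟨K', t', ht', hK'⟩ := hg
  exact ⟨max K K', t ∩ t', inter_mem ht ht', (hK.mono Set.inter_subset_left).prodMk
    (hK'.mono Set.inter_subset_right)⟩

lemma of_lipschitzOnWith {K : ℝ≥0} {f : E → F} {t : Set E} (h : LipschitzOnWith K f t)
    (hst : s ⊆ t) : LipschitzNear s f x :=
  ⟨K, s, self_mem_nhdsWithin, h.mono hst⟩

lemma of_lipschitzWith {K : ℝ≥0} {f : E → F} (h : LipschitzWith K f) : LipschitzNear s f x :=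
  of_lipschitzOnWith h.lipschitzOnWith (Set.subset_univ _)

lemma of_contDiffAt {E F : Type*} [NormedAddCommGroup E] [NormedSpace ℝ E]
    [NormedAddCommGroup F] [NormedSpace ℝ F] {s : Set E} {x : E} {f : E → F}
    (h : ContDiffAt ℝ 1 f x) : LipschitzNear s f x := by
  obtain ⟨K, t, ht, hK⟩ := h.exists_lipschitzOnWith
  exact ⟨K, t, mem_nhdsWithin_of_mem_nhds ht, hK⟩

variable {f g : E → ℝ}

lemma add (hf : LipschitzNear s f x) (hg : LipschitzNear s g x) (hx : x ∈ s) :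
    LipschitzNear s (fun y => f y + g y) x :=
  (of_contDiffAt (f := fun p : ℝ × ℝ => p.1 + p.2) (by fun_prop)).comp (hf.prodMk hg) hx

lemma sub (hf : LipschitzNear s f x) (hg : LipschitzNear s g x) (hx : x ∈ s) :
    LipschitzNear s (fun y => f y - g y) x :=
  (of_contDiffAt (f := fun p : ℝ × ℝ => p.1 - p.2) (by fun_prop)).comp (hf.prodMk hg) hx

lemma neg (hf : LipschitzNear s f x) (hx : x ∈ s) : LipschitzNear s (fun y => -f y) x :=
  (of_contDiffAt (f := fun p : ℝ => -p) (by fun_prop)).comp hf hx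

lemma mul (hf : LipschitzNear s f x) (hg : LipschitzNear s g x) (hx : x ∈ s) :
    LipschitzNear s (fun y => f y * g y) x :=
  (of_contDiffAt (f := fun p : ℝ × ℝ => p.1 * p.2) (by fun_prop)).comp (hf.prodMk hg) hx

lemma const_mul (c : ℝ) (hf : LipschitzNear s f x) (hx : x ∈ s) :
    LipschitzNear s (fun y => c * f y) x :=
  (of_contDiffAt (f := fun p : ℝ => c * p) (by fun_prop)).comp hf hx

lemma div (hf : LipschitzNear s f x) (hg : LipschitzNear s g x) (hx : x ∈ s) (h0 : g x ≠ 0) :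
    LipschitzNear s (fun y => f y / g y) x :=
  (of_contDiffAt (f := fun p : ℝ × ℝ => p.1 / p.2)
    (contDiffAt_fst.div contDiffAt_snd h0)).comp (hf.prodMk hg) hx

lemma max (hf : LipschitzNear s f x) (hg : LipschitzNear s g x) (hx : x ∈ s) :
    LipschitzNear s (fun y => max (f y) (g y)) x :=
  (of_lipschitzWith (f := fun p : ℝ × ℝ => Max.max p.1 p.2)
    (LipschitzWith.prod_fst.max LipschitzWith.prod_snd)).comp (hf.prodMk hg) hx

lemma abs (hf : LipschitzNear s f x) (hx : x ∈ s) : LipschitzNear s (fun y => |f y|) x :=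
  (of_lipschitzWith (f := fun p : ℝ => |p|) lipschitzWith_one_norm).comp hf hx

lemma const (c : F) : LipschitzNear s (fun _ => c) x := of_lipschitzWith (LipschitzWith.const c)

lemma inner {H : Type*} [NormedAddCommGroup H] [InnerProductSpace ℝ H] {f g : E → H}
    (hf : LipschitzNear s f x) (hg : LipschitzNear s g x) (hx : x ∈ s) :
    LipschitzNear s (fun y => (⟪f y, g y⟫ : ℝ)) x :=
  (of_contDiffAt (f := fun p : H × H => (⟪p.1, p.2⟫ : ℝ))
    (contDiff_inner.contDiffAt)).comp (hf.prodMk hg) hx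

end LipschitzNear

/-- The gradient of a `C²` function is locally Lipschitz. -/
lemma lipschitzNear_gradient {H : Type*} [NormedAddCommGroup H] [InnerProductSpace ℝ H]
    [CompleteSpace H] {s : Set H} {ψ : H → ℝ} {x : H} (hψ : ContDiffAt ℝ 2 ψ x) :
    LipschitzNear s (∇ ψ) x := by
  refine LipschitzNear.of_contDiffAt ?_
  have h : ContDiffAt ℝ 1 (fderiv ℝ ψ) x := hψ.fderiv_right (by norm_num)
  exact (InnerProductSpace.toDual ℝ H).symm.contDiff.contDiffAt.comp x h

end LipschitzNear

/-! ### Projection onto a half-line -/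

section HalfLine

/-- The point of `{u | 0 ≤ r + d u}` closest to `p`. -/
def halfLineProj (r d p : ℝ) : ℝ := p + max 0 (-(r + d * p)) / d

lemma halfLineProj_eq_iff {r d p : ℝ} (h : d = 0 → 0 ≤ r) (u : ℝ) :
    (0 ≤ r + d * u ∧ ∀ v, 0 ≤ r + d * v → |u - p| ≤ |v - p|) ↔ u = halfLineProj r d p := by
  unfold halfLineProj
  rcases le_or_gt 0 (r + d * p) with hp | hp
  · rw [max_eq_left (by linarith), zero_div, add_zero]
    constructor
    · rintro ⟨-, hu⟩
      have := hu p hp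
      rw [sub_self, abs_zero] at this
      exact sub_eq_zero.1 (abs_nonpos_iff.1 this)
    · rintro rfl
      exact ⟨hp, fun v _ => by simp⟩
  · have hd : d ≠ 0 := by
      rintro rfl
      have := h rfl
      linarith
    rw [max_eq_right (by linarith)]
    have hdist (v : ℝ) : d * (v - p) ≤ |d| * |v - p| := by rw [← abs_mul]; exact le_abs_self _
    have hd' : 0 < |d| := abs_pos.2 hd
    constructor
    · rintro ⟨hu, hmin⟩
      have h1 := hmin (p + -(r + d * p) / d) (by field_simp; linarith)
      rw [add_sub_cancel_left, abs_div, abs_of_pos (by linarith : 0 < -(r + d * p)),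
        le_div_iff₀ hd'] at h1
      have h2 := hdist u
      have h3 : d * (u - p) = -(r + d * p) := by linarith
      field_simp
      linarith
    · rintro rfl
      refine ⟨by field_simp; linarith, fun v hv => ?_⟩
      rw [add_sub_cancel_left, abs_div, abs_of_pos (by linarith : 0 < -(r + d * p)),
        div_le_iff₀ hd']
      have := hdist v
      linarith

end HalfLine

/-! ### The safety filter -/

namespace Setup

variable {n N : ℕ} (S : Setup n N)

/-- The constraint of the filter in normalised form, `0 ≤ filterOffset x + ⟪∇ψ x, b⟫ u`. -/
def filterOffset (x : State n) : ℝ :=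
  max (S.ξ₃ x) 0 / (S.μg x + √S.βg * S.σtg x) - max (-S.ξ₃ x) 0 / (S.μg x - √S.βg * S.σtg x)

/-- The control law of the safety filter. -/
def filterLaw (x : State n) : ℝ :=
  halfLineProj (S.filterOffset x) ⟪∇ S.ψ x, S.b⟫ (S.πnom x)

variable {S}

/-- Division by zero gives 0, so a quotient above 1 already forces a nonzero denominator. -/
lemma excitation_iff {x : State n} (hσlowg : 0 < S.σlowg)
    (h : 1 < S.μg x / (√S.βg * S.σtg x)) :
    0 < √S.βg * S.σtg x ∧ √S.βg * S.σtg x < S.μg x := by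
  have h0 : 0 ≤ √S.βg * S.σtg x :=
    mul_nonneg (Real.sqrt_nonneg _) (hσlowg.le.trans (le_max_right _ _))
  have hpos : 0 < √S.βg * S.σtg x := by
    refine h0.lt_of_ne fun h1 => ?_
    rw [← h1, div_zero] at h
    linarith
  rw [lt_div_iff₀ hpos, one_mul] at h
  exact ⟨hpos, h⟩

/-- Here w = μ_g + sgn(ξ₃) s with s = √β_g σ̃_g, since μ_g > 0 gives sgn(ξ₂) = -sgn(∇ψᵀb). The last
clause says that w is the worst value of g in the error band: ξ₃ < 0 forces q > 0 and the smallest g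
is worst; if ξ₃ > 0, only q < 0 can hurt and the largest g is worst; if ξ₃ = 0, q ≥ 0 and any
positive g will do. -/
lemma exists_normalisation {x : State n}
    (hs : 0 < √S.βg * S.σtg x ∧ √S.βg * S.σtg x < S.μg x) :
    ∃ w > 0, S.ξs x = -⟪∇ S.ψ x, S.b⟫ * w ∧ S.ξ₃ x = S.filterOffset x * w ∧
      ∀ g q, |g - S.μg x| ≤ √S.βg * S.σtg x → 0 ≤ S.ξ₃ x + q * w → 0 ≤ S.ξ₃ x + q * g := by
  obtain ⟨hs0, hsμ⟩ := hs
  set s := √S.βg * S.σtg x with hsdef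
  set d : ℝ := ⟪∇ S.ψ x, S.b⟫ with hd
  have hξ1 : S.ξ₁ x = |d| * s := by rw [ξ₁, hsdef, mul_assoc]
  have hξ2 : S.ξ₂ x = -d * S.μg x := rfl
  have hsgn : S.ξs x = -d * (S.μg x + Real.sign (S.ξ₃ x) * s) := by
    rw [ξs, hξ1, hξ2]
    have hμ : 0 < S.μg x := hs0.trans hsμ
    rcases lt_trichotomy d 0 with h | h | h <;> rcases lt_trichotomy (S.ξ₃ x) 0 with h' | h' | h'
    · rw [Real.sign_of_neg (by nlinarith [mul_pos (neg_pos.2 h) hμ]), Real.sign_of_neg h',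
        abs_of_neg h]; ring
    · rw [h', mul_zero, Real.sign_zero]; ring
    · rw [Real.sign_of_pos (by nlinarith [mul_pos (neg_pos.2 h) hμ]), Real.sign_of_pos h',
        abs_of_neg h]; ring
    · rw [h]; simp
    · rw [h]; simp
    · rw [h]; simp
    · rw [Real.sign_of_pos (by nlinarith [mul_pos h hμ]), Real.sign_of_neg h',
        abs_of_pos h]; ring
    · rw [h', mul_zero, Real.sign_zero]; ring
    · rw [Real.sign_of_neg (by nlinarith [mul_pos h hμ]), Real.sign_of_pos h',
        abs_of_pos h]; ring
  have hoff : S.filterOffset x = max (S.ξ₃ x) 0 / (S.μg x + s) - max (-S.ξ₃ x) 0 / (S.μg x - s) :=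
    rfl
  have hm : 0 < S.μg x - s := sub_pos.2 hsμ
  have hp : 0 < S.μg x + s := by linarith
  refine ⟨S.μg x + Real.sign (S.ξ₃ x) * s, ?_, hsgn, ?_, fun g q hg hq => ?_⟩
  · rcases Real.sign_apply_eq (S.ξ₃ x) with h | h | h <;> rw [h] <;> linarith
  · rw [hoff]
    rcases lt_trichotomy (S.ξ₃ x) 0 with h | h | h
    · rw [Real.sign_of_neg h, max_eq_right h.le, max_eq_left (by linarith), zero_div, zero_sub,
        neg_one_mul, ← sub_eq_add_neg, neg_div, neg_neg, div_mul_cancel₀ _ hm.ne']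
    · rw [h]; simp
    · rw [Real.sign_of_pos h, max_eq_left h.le, max_eq_right (by linarith), zero_div, sub_zero,
        one_mul, div_mul_cancel₀ _ hp.ne']
  · rw [abs_le] at hg
    rcases lt_trichotomy (S.ξ₃ x) 0 with h | h | h
    · rw [Real.sign_of_neg h] at hq
      have hq0 : 0 < q := by
        by_contra hc
        nlinarith [mul_nonneg (neg_nonneg.2 (not_lt.1 hc)) hm.le]
      nlinarith
    · rw [h, Real.sign_zero] at hq
      have hq0 : 0 ≤ q := by
        by_contra hc
        nlinarith [mul_pos (neg_pos.2 (not_le.1 hc)) (hs0.trans hsμ)]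
      rw [h, zero_add]
      exact mul_nonneg hq0 (by linarith)
    · rw [Real.sign_of_pos h] at hq
      rcases le_or_gt 0 q with hq0 | hq0
      · have : 0 ≤ q * g := mul_nonneg hq0 (by linarith)
        linarith
      · nlinarith

lemma mem_feasibleInputs_iff {x : State n}
    (hs : 0 < √S.βg * S.σtg x ∧ √S.βg * S.σtg x < S.μg x) (u : ℝ) :
    u ∈ S.feasibleInputs x ↔ 0 ≤ S.filterOffset x + ⟪∇ S.ψ x, S.b⟫ * u := by
  obtain ⟨w, hw, h1, h2, -⟩ := exists_normalisation hs
  rw [feasibleInputs, Set.mem_ofPred_eq, h1, h2, ← sub_nonneg]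
  rw [show S.filterOffset x * w - -⟪∇ S.ψ x, S.b⟫ * w * u =
    (S.filterOffset x + ⟪∇ S.ψ x, S.b⟫ * u) * w by ring]
  exact mul_nonneg_iff_of_pos_right hw

/-- By the gradient condition the constraint is slack where the input has no effect. -/
lemma filterOffset_pos {x : State n}
    (hs : 0 < √S.βg * S.σtg x ∧ √S.βg * S.σtg x < S.μg x) (hζ₂ : 0 < S.ζ₂)
    (hgrad : -⟪∇ S.ψ x, Matrix.toEuclideanLin S.A x⟫ + S.ζ₂ ≤ S.α (S.ψ x))
    (hd : ⟪∇ S.ψ x, S.b⟫ = (0 : ℝ)) : 0 < S.filterOffset x := by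
  obtain ⟨w, hw, -, h2, -⟩ := exists_normalisation hs
  have h3 : 0 < S.ξ₃ x := by
    rw [ξ₃, hd]
    simp only [abs_zero, zero_mul]
    linarith
  rw [h2] at h3
  exact pos_of_mul_pos_left h3 hw.le

lemma isFilterInput_iff {x : State n}
    (hs : 0 < √S.βg * S.σtg x ∧ √S.βg * S.σtg x < S.μg x)
    (hd : ⟪∇ S.ψ x, S.b⟫ = (0 : ℝ) → 0 < S.filterOffset x) (u : ℝ) :
    S.IsFilterInput x u ↔ u = S.filterLaw x := by
  rw [filterLaw, ← halfLineProj_eq_iff fun h => (hd h).le]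
  simp only [IsFilterInput, mem_feasibleInputs_iff hs]

/-- The control law of the filter is locally Lipschitz. -/
lemma lipschitzNear_filterLaw {x : State n} (hx : x ∈ S.X)
    (hs : 0 < √S.βg * S.σtg x ∧ √S.βg * S.σtg x < S.μg x)
    (hd : ⟪∇ S.ψ x, S.b⟫ = (0 : ℝ) → 0 < S.filterOffset x)
    (hψ : ContDiffAt ℝ 2 S.ψ x) {Lα : ℝ≥0} (hα : LipschitzWith Lα S.α)
    (hμf : LipschitzNear S.X S.μf x) (hμg : LipschitzNear S.X S.μg x)
    (hσf : LipschitzNear S.X S.σf x) (hσg : LipschitzNear S.X S.σg x)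
    (hπ : LipschitzNear S.X S.πnom x) : LipschitzNear S.X S.filterLaw x := by
  have hgr : LipschitzNear S.X (∇ S.ψ) x := lipschitzNear_gradient hψ
  have hψ1 : LipschitzNear S.X S.ψ x := LipschitzNear.of_contDiffAt (hψ.of_le (by norm_num))
  have hA : LipschitzNear S.X (fun y => Matrix.toEuclideanLin S.A y) x :=
    LipschitzNear.of_lipschitzWith
      (LinearMap.toContinuousLinearMap (Matrix.toEuclideanLin S.A)).lipschitz
  have hdl : LipschitzNear S.X (fun y => (⟪∇ S.ψ y, S.b⟫ : ℝ)) x :=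
    hgr.inner (LipschitzNear.const _) hx
  have hσtf : LipschitzNear S.X S.σtf x := hσf.max (LipschitzNear.const _) hx
  have hsl : LipschitzNear S.X (fun y => √S.βg * S.σtg y) x :=
    (hσg.max (LipschitzNear.const _) hx).const_mul _ hx
  have hξ : LipschitzNear S.X S.ξ₃ x :=
    (((((LipschitzNear.of_lipschitzWith hα).comp hψ1 hx).add (hgr.inner hA hx) hx).add
      (hdl.mul hμf hx) hx).sub (((hdl.abs hx).mul (LipschitzNear.const _) hx).mul hσtf hx) hx)
  have hoff : LipschitzNear S.X S.filterOffset x :=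
    ((hξ.max (LipschitzNear.const 0) hx).div (hμg.add hsl hx) hx (by linarith)).sub
      (((hξ.neg hx).max (LipschitzNear.const 0) hx).div (hμg.sub hsl hx) hx
        (by linarith)) hx
  have hc : LipschitzNear S.X
      (fun y => S.filterOffset y + ⟪∇ S.ψ y, S.b⟫ * S.πnom y) x := hoff.add (hdl.mul hπ hx) hx
  -- If ∇ψᵀb vanishes at x, the constraint is strictly satisfied by the nominal input near x, so the
  -- filter coincides with it there; otherwise the quotient is locally Lipschitz.
  by_cases h0 : ⟪∇ S.ψ x, S.b⟫ = (0 : ℝ)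
  · refine hπ.congr ?_
    have hpos : 0 < S.filterOffset x + ⟪∇ S.ψ x, S.b⟫ * S.πnom x := by
      rw [h0, zero_mul, add_zero]
      exact hd h0
    filter_upwards [(hc.continuousWithinAt hx).eventually (lt_mem_nhds hpos)] with y hy
    rw [filterLaw, halfLineProj, max_eq_left (by linarith), zero_div, add_zero]
  · exact hπ.add (((LipschitzNear.const 0).max (hc.neg hx) hx).div hdl hx h0) hx

end Setup

/-! ### Extension of the vector field and global solutions -/

section GlobalSolution

/-- A Lipschitz map on a bounded set extends to a bounded Lipschitz map. -/
lemma exists_bounded_lipschitz_extension {n : ℕ} {X : Set (State n)} (hX : IsCompact X) {K : ℝ≥0}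
    {v : State n → State n} (hv : LipschitzOnWith K v X) :
    ∃ (K' B : ℝ≥0) (w : State n → State n), LipschitzWith K' w ∧ (∀ x, ‖w x‖ ≤ B) ∧
      Set.EqOn v w X := by
  let e : State n ≃L[ℝ] (Fin n → ℝ) := EuclideanSpace.equiv (Fin n) ℝ
  have h1 : LipschitzOnWith (‖(e : State n →L[ℝ] (Fin n → ℝ))‖₊ * K) (fun x => e (v x)) X :=
    (e : State n →L[ℝ] (Fin n → ℝ)).lipschitz.comp_lipschitzOnWith hv
  obtain ⟨g, hg, hgv⟩ := h1.extend_pi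
  obtain ⟨R, hR⟩ := (hX.image_of_continuousOn h1.continuousOn).isBounded.exists_norm_le
  have hR' : ∀ x ∈ X, ∀ i, |e (v x) i| ≤ R := fun x hx i =>
    (norm_le_pi_norm (e (v x)) i).trans (hR _ ⟨x, hx, rfl⟩)
  set R' : ℝ≥0 := R.toNNReal
  have hRR' : R ≤ R' := Real.le_coe_toNNReal R
  -- Clamping each coordinate is 1-Lipschitz and leaves the values attained on `X` unchanged.
  let c : (Fin n → ℝ) → (Fin n → ℝ) := fun y i => max (-(R' : ℝ)) (min R' (y i))
  have hc : LipschitzWith 1 c := by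
    refine LipschitzWith.of_dist_le_mul fun y z => ?_
    refine (dist_pi_le_iff (by positivity)).2 fun i => ?_
    have h2 : LipschitzWith 1 fun r : ℝ => max (-(R' : ℝ)) (min (R' : ℝ) r) :=
      (LipschitzWith.id.const_min _).const_max _
    refine (h2.dist_le_mul _ _).trans ?_
    gcongr
    exact dist_le_pi_dist y z i
  have hcb (y) : ‖c y‖ ≤ R' := by
    refine (pi_norm_le_iff_of_nonneg R'.2).2 fun i => ?_
    rw [Real.norm_eq_abs, abs_le]
    exact ⟨le_max_left _ _, max_le (by linarith [R'.2]) (min_le_left _ _)⟩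
  set e' : (Fin n → ℝ) →L[ℝ] State n := (e.symm : (Fin n → ℝ) →L[ℝ] State n)
  refine ⟨_, ‖e'‖₊ * R', fun x => e' (c (g x)), e'.lipschitz.comp (hc.comp hg), fun x => ?_,
    fun x hx => ?_⟩
  · refine (e'.le_opNorm _).trans ?_
    rw [NNReal.coe_mul, coe_nnnorm]
    gcongr
    exact hcb _
  · have hgx : e (v x) = g x := hgv hx
    have : c (g x) = e (v x) := by
      ext i
      have := abs_le.1 (hR' x hx i)
      simp only [c, ← hgx]
      rw [min_eq_right (by linarith), max_eq_right (by linarith)]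
    simp only [this]
    exact (e.symm_apply_apply _).symm

variable {E : Type*} [NormedAddCommGroup E] [NormedSpace ℝ E]

/-- Uniqueness of solutions of an autonomous equation on an interval. -/
lemma eqOn_of_hasDerivWithinAt {w : E → E} {K : ℝ≥0} (hw : LipschitzWith K w) {T : ℝ} {y z : ℝ → E}
    (hy : ∀ t ∈ Set.Icc 0 T, HasDerivWithinAt y (w (y t)) (Set.Icc 0 T) t)
    (hz : ∀ t ∈ Set.Icc 0 T, HasDerivWithinAt z (w (z t)) (Set.Icc 0 T) t) (h0 : y 0 = z 0) :
    Set.EqOn y z (Set.Icc 0 T) := by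
  have hd {y : ℝ → E} (hy : ∀ t ∈ Set.Icc 0 T, HasDerivWithinAt y (w (y t)) (Set.Icc 0 T) t) (t)
      (ht : t ∈ Set.Ico 0 T) : HasDerivWithinAt y (w (y t)) (Set.Ici t) t :=
    (hy t ⟨ht.1, ht.2.le⟩).mono_of_mem_nhdsWithin
      (mem_of_superset (Icc_mem_nhdsGE ht.2) (Set.Icc_subset_Icc_left ht.1))
  exact ODE_solution_unique (v := fun _ => w) (fun _ => hw)
    (fun t ht => (hy t ht).continuousWithinAt) (hd hy)
    (fun t ht => (hz t ht).continuousWithinAt) (hd hz) h0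

/-- A bounded Lipschitz vector field has a solution for all nonnegative times. -/
lemma exists_global_solution [CompleteSpace E] {w : E → E} {K B : ℝ≥0} (hw : LipschitzWith K w)
    (hB : ∀ x, ‖w x‖ ≤ B) (x₀ : E) :
    ∃ x : ℝ → E, x 0 = x₀ ∧
      ∀ t ∈ Set.Ici (0 : ℝ), HasDerivWithinAt x (w (x t)) (Set.Ici 0) t := by
  have hex (m : ℕ) : ∃ y : ℝ → E, y 0 = x₀ ∧
      ∀ t ∈ Set.Icc (0 : ℝ) m, HasDerivWithinAt y (w (y t)) (Set.Icc (0 : ℝ) m) t := by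
    -- A field bounded by B moves at most B·m in time m, so a ball of that radius lets
    -- Picard–Lindelöf cover all of [0, m] at once.
    have hpl : IsPicardLindelof (fun _ => w) (tmin := 0) (tmax := m)
        ⟨0, Set.left_mem_Icc.2 m.cast_nonneg⟩ x₀ (B * m) 0 B K :=
      IsPicardLindelof.of_time_independent (fun x _ => hB x) hw.lipschitzOnWith (by simp)
    exact hpl.exists_eq_forall_mem_Icc_hasDerivWithinAt₀
  choose y hy0 hy using hex
  have hcompat {k m : ℕ} (hkm : k ≤ m) : Set.EqOn (y k) (y m) (Set.Icc 0 (k : ℝ)) := by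
    have hsub : Set.Icc (0 : ℝ) k ⊆ Set.Icc 0 (m : ℝ) :=
      Set.Icc_subset_Icc_right (by exact_mod_cast hkm)
    exact eqOn_of_hasDerivWithinAt hw (hy k) (fun t ht => (hy m t (hsub ht)).mono hsub)
      ((hy0 k).trans (hy0 m).symm)
  have hval (m : ℕ) (t : ℝ) (ht : t ∈ Set.Icc 0 (m : ℝ)) : y ⌈t⌉₊ t = y m t :=
    hcompat (Nat.ceil_le.2 ht.2) ⟨ht.1, Nat.le_ceil t⟩
  -- Solutions on [0, m] agree by uniqueness, so at time t any of them with m ≥ t may be used.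
  refine ⟨fun t => y ⌈t⌉₊ t, hy0 _, fun t ht => ?_⟩
  have ht' : t < (⌈t⌉₊ + 1 : ℕ) := by
    push_cast
    exact (Nat.le_ceil t).trans_lt (lt_add_one _)
  set m := ⌈t⌉₊ + 1
  have htm : t ∈ Set.Icc 0 (m : ℝ) := ⟨ht, ht'.le⟩
  have hmem : Set.Icc 0 (m : ℝ) ∈ 𝓝[Set.Ici 0] t := by
    rw [← Set.Ici_inter_Iic]
    exact inter_mem self_mem_nhdsWithin (mem_nhdsWithin_of_mem_nhds (Iic_mem_nhds ht'))
  have hd := (hy m t htm).mono_of_mem_nhdsWithin hmem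
  simp only [hval m t htm]
  refine hd.congr_of_eventuallyEq ?_ (hval m t htm)
  filter_upwards [hmem] with s hs using hval m s hs

end GlobalSolution

/-! ### Forward invariance of the safe set -/

section Invariance

/-- A function that is nonnegative initially, and whose derivative is at least `κ` times the
function wherever that is negative, stays nonnegative. -/
lemma nonneg_of_mul_le_deriv {y y' : ℝ → ℝ} {a b κ : ℝ}
    (hy : ContinuousOn y (Set.Icc a b)) (ha : 0 ≤ y a)
    (hd : ∀ t ∈ Set.Ico a b, HasDerivWithinAt y (y' t) (Set.Ici t) t)
    (hineq : ∀ t ∈ Set.Ico a b, y t < 0 → κ * y t ≤ y' t) :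
    ∀ t ∈ Set.Icc a b, 0 ≤ y t := by
  intro t ht
  have key (ε : ℝ) (hε : 0 < ε) : -y t ≤ ε * Real.exp ((κ + 1) * (t - a)) := by
    have hB (s : ℝ) : HasDerivAt (fun s => ε * Real.exp ((κ + 1) * (s - a)))
        (ε * (Real.exp ((κ + 1) * (s - a)) * (κ + 1))) s := by
      have h1 : HasDerivAt (fun s => (κ + 1) * (s - a)) (κ + 1) s := by
        simpa using ((hasDerivAt_id s).sub_const a).const_mul (κ + 1)
      exact h1.exp.const_mul ε
    -- At a first contact with the barrier, -y grows at most at rate κ while the barrier grows at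
    -- rate κ + 1; the strict gap rules out crossing, and then ε → 0.
    refine image_le_of_deriv_right_lt_deriv_boundary (f := fun s => -y s) hy.neg
      (fun s hs => (hd s hs).neg) (by simpa using by linarith) hB (fun s hs heq => ?_) ht
    have hpos : 0 < ε * Real.exp ((κ + 1) * (s - a)) := by positivity
    have hneg : y s < 0 := by linarith
    have := hineq s hs hneg
    have e : y s = -(ε * Real.exp ((κ + 1) * (s - a))) := by linarith
    rw [e] at this
    nlinarith
  have hlim : Tendsto (fun ε : ℝ => ε * Real.exp ((κ + 1) * (t - a))) (𝓝[>] 0) (𝓝 0) :=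
    (Continuous.tendsto' (by fun_prop) 0 0 (by simp)).mono_left nhdsWithin_le_nhds
  have := ge_of_tendsto hlim (by filter_upwards [self_mem_nhdsWithin] with ε hε using key ε hε)
  linarith

variable {E : Type*} [NormedAddCommGroup E] [InnerProductSpace ℝ E] [CompleteSpace E]

/-- Near a regular zero `p` of `ψ`, a lower bound for the derivative of `ψ` along a vector field
that points inwards on the zero set. -/
lemma exists_mul_le_inner_gradient {ψ : E → ℝ} {w : E → E} {K : ℝ≥0} (hw : LipschitzWith K w)
    {X : Set E} {p : E} (hψ : ContDiffAt ℝ 2 ψ p) (hp : ψ p = 0) (hne : ∇ ψ p ≠ 0)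
    (hX : ∀ᶠ y in 𝓝 p, 0 ≤ ψ y → y ∈ X)
    (hin : ∀ x ∈ X, ψ x = 0 → 0 ≤ (⟪∇ ψ x, w x⟫ : ℝ)) :
    ∃ κ : ℝ, ∀ᶠ y in 𝓝 p, ψ y < 0 → κ * ψ y ≤ ⟪∇ ψ y, w y⟫ := by
  set v := ∇ ψ p with hv
  set c : ℝ := ‖v‖ ^ 2 with hc
  have hv0 : 0 < ‖v‖ := norm_pos_iff.2 hne
  have hc0 : 0 < c := by positivity
  have hgrad : LipschitzNear Set.univ (∇ ψ) p := lipschitzNear_gradient hψ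
  have hgc : ContinuousAt (∇ ψ) p :=
    continuousWithinAt_univ _ _ |>.1 (hgrad.continuousWithinAt trivial)
  obtain ⟨L, t, ht, hL⟩ : LipschitzNear Set.univ (fun y => (⟪∇ ψ y, w y⟫ : ℝ)) p :=
    hgrad.inner (LipschitzNear.of_lipschitzWith hw) trivial
  rw [nhdsWithin_univ] at ht
  have hdiff : ∀ᶠ y in 𝓝 p, DifferentiableAt ℝ ψ y := by
    filter_upwards [hψ.eventually (by simp)] with y hy using hy.differentiableAt (by norm_num)
  have hlow : ∀ᶠ y in 𝓝 p, c / 2 < (⟪∇ ψ y, v⟫ : ℝ) := by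
    have h1 : ContinuousAt (fun y => (⟪∇ ψ y, v⟫ : ℝ)) p := hgc.inner continuousAt_const
    refine h1.eventually (lt_mem_nhds ?_)
    show c / 2 < (⟪∇ ψ p, v⟫ : ℝ)
    rw [← hv, real_inner_self_eq_norm_sq]
    linarith
  obtain ⟨ρ, hρ, hball⟩ := Metric.eventually_nhds_iff_ball.1 (((hdiff.and hlow).and hX).and ht)
  have hsmall : ∀ᶠ y in 𝓝 p, 2 * -ψ y / c * ‖v‖ < ρ / 2 := by
    have h1 : ContinuousAt (fun y => 2 * -ψ y / c * ‖v‖) p := by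
      have := hψ.continuousAt
      fun_prop
    refine h1.eventually (gt_mem_nhds ?_)
    show 2 * -ψ p / c * ‖v‖ < ρ / 2
    rw [hp]
    simpa using hρ
  refine ⟨L * (2 * ‖v‖ / c), ?_⟩
  filter_upwards [hsmall, Metric.ball_mem_nhds p (half_pos hρ)] with y hy hyp hyneg
  -- Along v = ∇ψ(p) the function ψ grows at rate at least c/2, so starting from ψ(y) < 0 it reaches
  -- zero by time `s₁`.
  set s₁ : ℝ := 2 * -ψ y / c with hs₁
  have hs₁0 : 0 ≤ s₁ := div_nonneg (by linarith) hc0.le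
  have hmem (s : ℝ) (hs : s ∈ Set.Icc 0 s₁) : y + s • v ∈ Metric.ball p ρ := by
    rw [Metric.mem_ball, dist_eq_norm] at hyp ⊢
    have h1 : ‖s • v‖ ≤ s₁ * ‖v‖ := by
      rw [norm_smul, Real.norm_of_nonneg hs.1]
      gcongr
      exact hs.2
    calc ‖y + s • v - p‖ = ‖(y - p) + s • v‖ := by congr 1; abel
      _ ≤ ‖y - p‖ + ‖s • v‖ := norm_add_le _ _
      _ < ρ := by linarith
  have hderiv (s : ℝ) (hs : s ∈ Set.Icc 0 s₁) :
      HasDerivAt (fun s => ψ (y + s • v)) (⟪∇ ψ (y + s • v), v⟫ : ℝ) s := by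
    have h1 : HasDerivAt (fun s : ℝ => y + s • v) v s := by
      simpa using ((hasDerivAt_id s).smul_const v).const_add y
    have h2 := (hball _ (hmem s hs)).1.1.1.hasGradientAt.hasFDerivAt.comp_hasDerivAt s h1
    simpa using! h2
  have hcont : ContinuousOn (fun s => ψ (y + s • v)) (Set.Icc 0 s₁) := fun s hs =>
    (hderiv s hs).continuousAt.continuousWithinAt
  have hend : 0 ≤ ψ (y + s₁ • v) := by
    have h := (convex_Icc 0 s₁).mul_sub_le_image_sub_of_le_deriv hcont
      (fun s hs => (hderiv s (interior_subset hs)).differentiableAt.differentiableWithinAt)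
      (C := c / 2) (fun s hs => by
        rw [(hderiv s (interior_subset hs)).deriv]
        exact (hball _ (hmem s (interior_subset hs))).1.1.2.le)
      0 (Set.left_mem_Icc.2 hs₁0) s₁ (Set.right_mem_Icc.2 hs₁0) hs₁0
    have e : c / 2 * (s₁ - 0) = -ψ y := by
      rw [hs₁]
      field_simp
      ring
    rw [e, zero_smul, add_zero] at h
    linarith
  obtain ⟨s, hs, hs0⟩ := intermediate_value_Icc hs₁0 hcont
    (show (0 : ℝ) ∈ Set.Icc _ _ from ⟨by simpa using hyneg.le, hend⟩)
  have hz := hball _ (hmem s hs)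
  have hyz := hball y (Metric.ball_subset_ball (by linarith) hyp)
  -- The field points inwards at the zero just found; the Lipschitz bound for ⟪∇ψ, w⟫ carries this
  -- back to y with an error proportional to -ψ(y), which gives κ.
  have h1 := hin _ (hz.1.2 hs0.ge) hs0
  have h2 := (abs_le.1 ((Real.dist_eq _ _) ▸ hL.dist_le_mul y hyz.2 _ hz.2)).1
  have h3 : dist y (y + s • v) ≤ s₁ * ‖v‖ := by
    rw [dist_self_add_right, norm_smul, Real.norm_of_nonneg hs.1]
    gcongr
    exact hs.2
  have h4 : (L : ℝ) * dist y (y + s • v) ≤ L * (s₁ * ‖v‖) := by gcongr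
  have h5 : (L : ℝ) * (s₁ * ‖v‖) = -(L * (2 * ‖v‖ / c) * ψ y) := by
    rw [hs₁]
    ring
  linarith

/-- Forward invariance of `{x ∈ X | 0 ≤ ψ x}` under a vector field that points inwards on the
zeros of `ψ`, which are regular. -/
theorem forward_invariant {ψ : E → ℝ} {w : E → E} {K : ℝ≥0} (hw : LipschitzWith K w) {X : Set E}
    (hXc : IsClosed X) (hψ : ∀ x ∈ X, ContDiffAt ℝ 2 ψ x)
    (hC : ∀ x ∈ X, 0 ≤ ψ x → ∀ᶠ y in 𝓝 x, 0 ≤ ψ y → y ∈ X)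
    (hne : ∀ x ∈ X, ψ x = 0 → ∇ ψ x ≠ 0)
    (hin : ∀ x ∈ X, ψ x = 0 → 0 ≤ (⟪∇ ψ x, w x⟫ : ℝ)) {x : ℝ → E}
    (hx : ∀ t ∈ Set.Ici (0 : ℝ), HasDerivWithinAt x (w (x t)) (Set.Ici 0) t)
    (hx0 : x 0 ∈ X ∧ 0 ≤ ψ (x 0)) {t : ℝ} (ht : 0 ≤ t) : x t ∈ X ∧ 0 ≤ ψ (x t) := by
  have hclosed : IsClosed (X ∩ ψ ⁻¹' Set.Ici 0) :=
    ContinuousOn.preimage_isClosed_of_isClosed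
      (fun x hx => (hψ x hx).continuousAt.continuousWithinAt) hXc isClosed_Ici
  have hxc : ContinuousOn x (Set.Ici 0) := fun s hs => (hx s hs).continuousWithinAt
  have hsub : Set.Icc 0 t ⊆ {s | x s ∈ X ∩ ψ ⁻¹' Set.Ici 0} := by
    -- Continuous induction in time: the good times form a closed set, and from each of them the
    -- trajectory stays in the set a little longer.
    refine IsClosed.Icc_subset_of_forall_exists_gt ?_ hx0 fun s hs u hu => ?_
    · rw [Set.inter_comm]
      exact (hxc.mono Set.Icc_subset_Ici_self).preimage_isClosed_of_isClosed isClosed_Icc hclosed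
    obtain ⟨⟨hsX, hsψ⟩, hs0, hst⟩ := hs
    have hsψ : 0 ≤ ψ (x s) := hsψ
    have hxs : ContinuousWithinAt x (Set.Ici s) s :=
      (hxc s hs0).mono (Set.Ici_subset_Ici.2 hs0)
    have hdiff : ∀ᶠ y in 𝓝 (x s), DifferentiableAt ℝ ψ y := by
      filter_upwards [(hψ _ hsX).eventually (by simp)] with y hy
        using hy.differentiableAt (by norm_num)
    obtain ⟨κ, hκψ⟩ : ∃ κ : ℝ,
        ∀ᶠ y in 𝓝 (x s), ψ y < 0 → κ * ψ y ≤ ⟪∇ ψ y, w y⟫ := by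
      -- Only boundary points need the derivative bound; where ψ > 0 it is vacuous nearby.
      rcases hsψ.eq_or_lt with h | h
      · exact exists_mul_le_inner_gradient hw (hψ _ hsX) h.symm (hne _ hsX h.symm)
          (hC _ hsX hsψ) hin
      · refine ⟨0, ?_⟩
        filter_upwards [(hψ _ hsX).continuousAt.eventually (lt_mem_nhds h)] with y hy hy'
        exact absurd hy' hy.not_gt
    have hgood := hxs.eventually ((hdiff.and hκψ).and (hC _ hsX hsψ))
    obtain ⟨b, hb, hIcc⟩ := mem_nhdsGE_iff_exists_Icc_subset.1 hgood
    have hsb : s < min b u := lt_min hb hu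
    refine ⟨min b u, ?_, hsb, min_le_right _ _⟩
    have hI : Set.Icc s (min b u) ⊆ Set.Icc s b := Set.Icc_subset_Icc_right (min_le_left _ _)
    have hnonneg := nonneg_of_mul_le_deriv (y := fun r => ψ (x r))
      (y' := fun r => ⟪∇ ψ (x r), w (x r)⟫) (a := s) (b := min b u) (κ := κ) ?_ hsψ ?_ ?_ (min b u)
      (Set.right_mem_Icc.2 hsb.le)
    · exact ⟨(hIcc (hI (Set.right_mem_Icc.2 hsb.le))).2 hnonneg, hnonneg⟩
    · intro r hr
      exact (hIcc (hI hr)).1.1.continuousAt.comp_continuousWithinAt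
        ((hxc r (le_trans hs0 hr.1)).mono fun q hq => le_trans hs0 hq.1)
    · intro r hr
      have hr' : r ∈ Set.Icc s b := hI ⟨hr.1, hr.2.le⟩
      have h0r : (0 : ℝ) ≤ r := le_trans hs0 hr.1
      have h2 := (hIcc hr').1.1.hasGradientAt.hasFDerivAt.comp_hasDerivWithinAt r
        ((hx r h0r).mono (Set.Ici_subset_Ici.2 h0r))
      simpa using! h2
    · exact fun r hr => (hIcc (hI ⟨hr.1, hr.2.le⟩)).1.2
  exact hsub (Set.right_mem_Icc.2 ht)

end Invariance

end SafeGP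

/-! ### Safety of the closed loop -/

namespace SafeGP.Setup

variable {n N : ℕ} {S : Setup n N}

/-- Under the error bounds for the posterior means the filter enforces the barrier condition for
the true system. -/
lemma barrier_condition {f g : State n → ℝ} {x : State n} {u : ℝ}
    (hs : 0 < √S.βg * S.σtg x ∧ √S.βg * S.σtg x < S.μg x)
    (hu : 0 ≤ S.filterOffset x + ⟪∇ S.ψ x, S.b⟫ * u)
    (hf : |f x - S.μf x| ≤ √S.βf * S.σtf x) (hg : |g x - S.μg x| ≤ √S.βg * S.σtg x) :
    0 ≤ S.α (S.ψ x) + ⟪∇ S.ψ x, dynamics S.A S.b f g x u⟫ := by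
  obtain ⟨w, hw, -, h2, h3⟩ := exists_normalisation hs
  set d : ℝ := ⟪∇ S.ψ x, S.b⟫ with hd
  have h4 : 0 ≤ S.ξ₃ x + d * u * g x := by
    refine h3 (g x) (d * u) hg ?_
    rw [h2, ← add_mul]
    exact mul_nonneg hu hw.le
  have h5 : -(d * (f x - S.μf x)) ≤ |d| * √S.βf * S.σtf x := by
    refine (neg_le_abs _).trans ?_
    rw [abs_mul, mul_assoc]
    gcongr
  rw [ξ₃, ← hd] at h4
  rw [dynamics, inner_add_right, inner_smul_right, ← hd]
  linarith

/-- The closed loop is safe if the posterior standard deviations bound the errors of the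
posterior means. -/
lemma isSafe_filterLaw {f g : State n → ℝ} (hX : IsCompact S.X)
    (hψ : ∀ x ∈ S.X, ContDiffAt ℝ 2 S.ψ x) (hα0 : S.α 0 = 0)
    (hC : ∀ᶠ x in 𝓝ˢ S.safeSet, 0 ≤ S.ψ x → x ∈ S.X)
    (hs : ∀ x ∈ S.X, 0 < √S.βg * S.σtg x ∧ √S.βg * S.σtg x < S.μg x)
    (hoff : ∀ x ∈ S.X, ⟪∇ S.ψ x, S.b⟫ = (0 : ℝ) → 0 < S.filterOffset x)
    (hne : ∀ x ∈ S.X, S.ψ x = 0 → ∇ S.ψ x ≠ 0)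
    {Lπ : ℝ≥0} (hπ : LipschitzOnWith Lπ S.filterLaw S.X) (hadm : S.Admissible f g)
    (hbound : ∀ x ∈ S.X, |f x - S.μf x| ≤ √S.βf * S.σtf x ∧
      |g x - S.μg x| ≤ √S.βg * S.σtg x) :
    S.IsSafe f g S.filterLaw := by
  have hsub : S.X ⊆ convexHull ℝ S.X := subset_convexHull ℝ S.X
  have hloc : LocallyLipschitzOn S.X fun x => dynamics S.A S.b f g x (S.filterLaw x) := by
    intro x hx
    have hf : LipschitzNear S.X f x := LipschitzNear.of_lipschitzOnWith hadm.lipschitz_f hsub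
    have hg : LipschitzNear S.X g x := LipschitzNear.of_lipschitzOnWith hadm.lipschitz_g hsub
    have hp : LipschitzNear S.X S.filterLaw x := LipschitzNear.of_lipschitzOnWith hπ subset_rfl
    have hA : LipschitzNear S.X (fun y => Matrix.toEuclideanLin S.A y) x :=
      LipschitzNear.of_lipschitzWith
        (LinearMap.toContinuousLinearMap (Matrix.toEuclideanLin S.A)).lipschitz
    have hsmul : LipschitzNear Set.univ (fun p : State n × ℝ => p.1 + p.2 • S.b)
        (Matrix.toEuclideanLin S.A x, f x + g x * S.filterLaw x) :=
      LipschitzNear.of_contDiffAt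
        (contDiffAt_fst.add (contDiffAt_snd.smul contDiffAt_const))
    exact LipschitzNear.comp (f := fun y => (Matrix.toEuclideanLin S.A y,
      f y + g y * S.filterLaw y)) hsmul (hA.prodMk (hf.add (hg.mul hp hx) hx)) hx
  obtain ⟨K, hK⟩ := hloc.exists_lipschitzOnWith_of_compact hX
  obtain ⟨K', B, w, hw, hB, hEq⟩ := exists_bounded_lipschitz_extension hX hK
  have hC' (x) (hx : x ∈ S.X) (h0 : 0 ≤ S.ψ x) : ∀ᶠ y in 𝓝 x, 0 ≤ S.ψ y → y ∈ S.X :=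
    hC.filter_mono (nhds_le_nhdsSet (show x ∈ S.safeSet from ⟨hx, h0⟩))
  have hin (x) (hx : x ∈ S.X) (h0 : S.ψ x = 0) : 0 ≤ (⟪∇ S.ψ x, w x⟫ : ℝ) := by
    have h1 := (halfLineProj_eq_iff (p := S.πnom x) (fun h => (hoff x hx h).le) _).2 rfl
    have h2 := barrier_condition (hs x hx) h1.1 (hbound x hx).1 (hbound x hx).2
    rw [h0, hα0, zero_add] at h2
    rw [← hEq hx]
    exact h2
  intro x₀ hx₀
  obtain ⟨x, hx0, hx⟩ := exists_global_solution hw hB x₀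
  have hinv (t : ℝ) (ht : 0 ≤ t) : x t ∈ S.X ∧ 0 ≤ S.ψ (x t) :=
    forward_invariant hw hX.isClosed hψ hC' hne hin hx (hx0 ▸ hx₀) ht
  refine ⟨x, hx0, fun t ht => ⟨(hinv t ht).1, ?_⟩, hinv, fun T z hz0 hz => ?_⟩
  · have : dynamics S.A S.b f g (x t) (S.filterLaw (x t)) = w (x t) := hEq (hinv t ht).1
    rw [this]
    exact hx t ht
  -- A competing closed-loop solution lies in `X` by definition, so it also solves the extended
  -- equation, where uniqueness holds.
  · refine eqOn_of_hasDerivWithinAt hw (fun t ht => ?_)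
      (fun t ht => (hx t ht.1).mono Set.Icc_subset_Ici_self) (hz0.trans hx0.symm)
    have h := (hz t ht).2
    have e : dynamics S.A S.b f g (z t) (S.filterLaw (z t)) = w (z t) := hEq (hz t ht).1
    rwa [e] at h

end SafeGP.Setup

end

theorem proposition1 {n N : ℕ} (S : SafeGP.Setup n N)
    {Ω : Type*} [MeasurableSpace Ω] (P : Measure Ω) [IsProbabilityMeasure P]
    (F G : SafeGP.State n → Ω → ℝ)
    -- independent centred Gaussian process priors for the unknown functions, noisy data
    (hF : SafeGP.IsCenteredGP F S.kf P) (hG : SafeGP.IsCenteredGP G S.kg P)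
    (hFG : IndepFun (fun ω x => F x ω) (fun ω x => G x ω) P)
    (hsf : 0 ≤ S.sf) (hkf : ∀ x, S.kf x x = S.sf ^ 2)
    (hσon : 0 < S.σon)
    -- the domain and the constants
    (hX : IsCompact S.X)
    (hδ : S.δ ∈ Set.Ioo (0 : ℝ) 1) (hσlowf : 0 < S.σlowf) (hσlowg : 0 < S.σlowg)
    (hglow : 0 < S.glow)
    -- Lipschitz constants of the posterior means and standard deviations
    (hμf : LipschitzOnWith S.Lμf S.μf (convexHull ℝ S.X))
    (hμg : LipschitzOnWith S.Lμg S.μg (convexHull ℝ S.X))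
    (hσf : LipschitzOnWith S.Lσf S.σf (convexHull ℝ S.X))
    (hσg : LipschitzOnWith S.Lσg S.σg (convexHull ℝ S.X))
    -- the nominal control law is Lipschitz
    (hπnom : ∃ L : ℝ≥0, LipschitzOnWith L S.πnom S.X)
    -- control barrier function for the nominal system `f = 0`, `g = 1`
    (hψ : ∃ V : Set (SafeGP.State n), IsOpen V ∧ S.X ⊆ V ∧ ContDiffOn ℝ 2 S.ψ V)
    (hα : ∃ L : ℝ≥0, LipschitzWith L S.α)
    (hCBF : SafeGP.IsCBF S.A S.b (fun _ => 0) (fun _ => 1) S.U S.ψ S.α S.safeSet)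
    (hC : ∀ᶠ x in 𝓝ˢ S.safeSet, 0 ≤ S.ψ x → x ∈ S.X)
    -- gradient condition
    (hζ₁ : 0 < S.ζ₁) (hζ₂ : 0 < S.ζ₂)
    (hgrad : ∀ x ∈ S.X, |⟪∇ S.ψ x, S.b⟫| ≤ S.ζ₁ →
      -⟪∇ S.ψ x, Matrix.toEuclideanLin S.A x⟫ + S.ζ₂ ≤ S.α (S.ψ x))
    -- excitation condition
    (hexc : ∀ x ∈ S.X, 1 < S.μg x / (√S.βg * S.σtg x)) :
    -- the filter is feasible
    (∀ x ∈ S.X, (S.feasibleInputs x).Nonempty) ∧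
    -- it is a well-defined Lipschitz control law
    ∃ π : SafeGP.State n → ℝ,
      (∀ x ∈ S.X, ∀ u, S.IsFilterInput x u ↔ u = π x) ∧
      (∃ L : ℝ≥0, LipschitzOnWith L π S.X) ∧
      -- with posterior probability at least `1 - δ` it is safe
      ∃ E : Set Ω, MeasurableSet E ∧
        ENNReal.ofReal (1 - S.δ) ≤ SafeGP.posterior P F G S.D S.σon E ∧
        ∀ ω ∈ E, S.Admissible (fun x => F x ω) (fun x => G x ω) →
          S.IsSafe (fun x => F x ω) (fun x => G x ω) π := by

  obtain ⟨V, hVo, hXV, hψV⟩ := hψ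
  obtain ⟨Lα, hα⟩ := hα
  obtain ⟨Lπ, hπ⟩ := hπnom
  have hψ' (x) (hx : x ∈ S.X) : ContDiffAt ℝ 2 S.ψ x :=
    hψV.contDiffAt (hVo.mem_nhds (hXV hx))
  have hs (x) (hx : x ∈ S.X) := SafeGP.Setup.excitation_iff hσlowg (hexc x hx)
  have hoff (x) (hx : x ∈ S.X) (hd : ⟪∇ S.ψ x, S.b⟫ = (0 : ℝ)) : 0 < S.filterOffset x :=
    SafeGP.Setup.filterOffset_pos (hs x hx) hζ₂
      (hgrad x hx (by rw [hd, abs_zero]; exact hζ₁.le)) hd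
  -- At a critical zero of ψ the gradient condition would read ζ₂ ≤ α(0) = 0.
  have hne (x) (hx : x ∈ S.X) (h0 : S.ψ x = 0) : ∇ S.ψ x ≠ 0 := by
    intro hg
    have h := hgrad x hx (by rw [hg, inner_zero_left, abs_zero]; exact hζ₁.le)
    rw [hg, inner_zero_left, h0, hCBF.1.map_zero] at h
    linarith
  have hsub : S.X ⊆ convexHull ℝ S.X := subset_convexHull ℝ S.X
  have hloc : LocallyLipschitzOn S.X S.filterLaw := fun x hx =>
    SafeGP.Setup.lipschitzNear_filterLaw hx (hs x hx) (hoff x hx) (hψ' x hx) hα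
      (SafeGP.LipschitzNear.of_lipschitzOnWith hμf hsub)
      (SafeGP.LipschitzNear.of_lipschitzOnWith hμg hsub)
      (SafeGP.LipschitzNear.of_lipschitzOnWith hσf hsub)
      (SafeGP.LipschitzNear.of_lipschitzOnWith hσg hsub)
      (SafeGP.LipschitzNear.of_lipschitzOnWith hπ subset_rfl)
  -- On a compact set local Lipschitz bounds give a global one; `X` need not be convex.
  obtain ⟨K, hK⟩ := hloc.exists_lipschitzOnWith_of_compact hX
  have hfilter (x) (hx : x ∈ S.X) := SafeGP.Setup.isFilterInput_iff (hs x hx) (hoff x hx)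
  obtain ⟨E, hE, hPE, hbound⟩ := S.exists_event_uniform_bound hF hG hFG hσon hX hδ hσlowf hσlowg
    hμf hμg hσf hσg
  exact ⟨fun x hx => ⟨S.filterLaw x, ((hfilter x hx _).2 rfl).1⟩, S.filterLaw, hfilter, ⟨K, hK⟩,
    E, hE, hPE, fun ω hω hadm => SafeGP.Setup.isSafe_filterLaw hX hψ' hCBF.1.map_zero hC hs hoff
      hne hK hadm (hbound ω hω hadm)⟩
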